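/- Let $n\ge 1$, let $\mathcal D$ be a probability distribution on $[n]=\{1,\dots,n\}$ with $\mathcal D(x)>0$ for all $x$, put $\mathcal D_{\min}=\min_x\mathcal D(x)$, and let $\mathcal Q$ be a probability distribution on the two-element subsets of $[n]$. Write $\mathcal Q(x,y)$ for the probability of $\{x,y\}$. A sample from the local sampling scheme $\mathrm{Samp}(\mathcal Q;\mathcal D)$ is a pair $\{i,j\}$ drawn from $\mathcal Q$ together with a winner $w\in\{i,j\}$, where $w=i$ with probability $\mathcal D(i)/(\mathcal D(i)+\mathcal D(j))$. Assume that the comparison graph on $[n]$, whose edges are the pairs $\{x,y\}$ with $\mathcal Q(x,y)>0$, is connected. Let $M$ be the matrix with $M_{xy}=\mathcal Q(x,y)\,\mathcal D(y)/(\mathcal D(x)+\mathcal D(y))$ for $x\ne y$ and $M_{xx}=1-\sum_{y\ne x}M_{xy}$. It is a transition matrix whose unique stationary distribution is $\mathcal D$. Its eigenvalues $1=\lambda_1\ge\dots\ge\lambda_n$ are real, and its absolute spectral gap $\Gamma(M)=1-\max\{\lambda_2,|\lambda_n|\}$ is positive. Consider the following algorithm (coupling from the past). Start with $F_0(x)=x$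 for all $x\in[n]$. While the map $F_{-t}$ is not constant, draw a fresh independent sample $(\{i,j\},w)$ and set $F_{-(t+1)}(x)=F_{-t}(x)$ if $x\notin\{i,j\}$ or $x=w$, and $F_{-(t+1)}(x)=F_{-t}(w)$ otherwise. When $F_{-t}$ is constant, output $F_{-t}(1)$. In each draw, a state $x$ moves to $y$ with probability $M_{xy}$. Then the algorithm stops with probability $1$, and its output is distributed exactly as $\mathcal D$. There is a universal constant $C>0$ such that for every $\delta>0$, with probability at least $1-\delta$, the number $N$ of samples that it draws satisfies $$N\le C\,\frac{n\log(1/\mathcal D_{\min})}{\Gamma(M)}\,\max\Bigl\{1,\log\frac1\delta\Bigr\}.$$ Moreover, almost surely, the algorithm runs in time polynomial in the number $N$ of samples drawn: it is implemented by a fixed program for a unit-cost random-access machine (whose only arithmetic operation is adding one), with $n$ as input and an oracle for the samples, whose number of steps is at most $p(N)$ for a universal polynomial $p$. -/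

import Mathlib

open MeasureTheory ProbabilityTheory

noncomputable section

namespace CFTP

/-! ### Local sampling schemes -/

/-- One answer of the oracle: the set that is compared and the winner of the comparison. -/
@[ext]
structure Comparison (Z : Type*) where
  winner : Z
  set : Finset Z

/-- Comparisons form a discrete space: every set of comparisons is measurable. -/
instance (Z : Type*) : MeasurableSpace (Comparison Z) := ⊤

/-- The data of a local sampling scheme `Samp(Q; D)` on `Z`: a target distribution `D` whose
support is `Z`, and a distribution `Q` on nonempty subsets of `Z`. -/
structure LocalSamplingScheme (Z : Type*) where
  D : PMF Z
  Q : PMF (Finset Z)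
  mem_support_D : ∀ z, z ∈ D.support
  nonempty_of_mem_support_Q : ∀ S ∈ Q.support, S.Nonempty

namespace LocalSamplingScheme

variable {Z : Type*} (L : LocalSamplingScheme Z)

/-- The conditional distribution `D_S`, `D_S(x) = D(x) 1{x ∈ S} / D(S)`. -/
def condD (S : Finset Z) (hS : S ∈ L.Q.support) : PMF Z :=
  L.D.filter (S : Set Z)
    ⟨(L.nonempty_of_mem_support_Q S hS).choose,
      Finset.mem_coe.2 (L.nonempty_of_mem_support_Q S hS).choose_spec, L.mem_support_D _⟩

/-- The law of one oracle answer: draw `S` from `Q`, then draw the winner from `D_S`. -/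
def samp : PMF (Comparison Z) :=
  L.Q.bindOnSupport fun S hS => (L.condD S hS).map fun x => ⟨x, S⟩

/-- `Q` is a pair distribution: only sets with exactly two elements are compared. -/
def IsPairwise : Prop := ∀ S ∈ L.Q.support, S.card = 2

variable [DecidableEq Z]

/-- The comparison graph: `u` and `v` are adjacent if the pair `{u, v}` is in the support of
`Q`. -/
def graph : SimpleGraph Z where
  Adj u v := u ≠ v ∧ ({u, v} : Finset Z) ∈ L.Q.support
  symm := ⟨fun u v h => ⟨h.1.symm, by rw [Finset.pair_comm]; exact h.2⟩⟩
  loopless := ⟨fun _ h => h.1 rfl⟩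

/-- The target probabilities as real numbers. -/
def prob (x : Z) : ℝ := (L.D x).toReal

/-- The smallest target probability. -/
def minProb : ℝ := ⨅ x, L.prob x

/-- `Q(x, y)`, the probability that the pair `{x, y}` is drawn. -/
def pairProb (x y : Z) : ℝ := (L.Q {x, y}).toReal

/-- The canonical transition matrix. -/
def chain [Fintype Z] : Matrix Z Z ℝ := fun x y =>
  if x = y then
    1 - ∑ z ∈ Finset.univ.erase x, L.pairProb x z * (L.prob z / (L.prob x + L.prob z))
  else L.pairProb x y * (L.prob y / (L.prob x + L.prob y))

end LocalSamplingScheme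

/-! ### The absolute spectral gap -/

/-- The `k`-th largest real eigenvalue (counted with algebraic multiplicity, starting with
`k = 0`). For a reversible transition matrix all eigenvalues are real. -/
def eigenvalueDesc {n : ℕ} (P : Matrix (Fin n) (Fin n) ℝ) (k : ℕ) : ℝ :=
  (P.charpoly.roots.sort (fun a b => b ≤ a)).getD k 0

/-- The absolute spectral gap `1 - max {λ₂, |λₙ|}` of a reversible transition matrix with
spectrum `1 = λ₁ ≥ λ₂ ≥ ⋯ ≥ λₙ`. -/
def absSpectralGap {n : ℕ} (P : Matrix (Fin n) (Fin n) ℝ) : ℝ :=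
  1 - max (eigenvalueDesc P 1) |eigenvalueDesc P (n - 1)|

/-! ### Coupling from the past -/

section Flow

variable {Z : Type*} [DecidableEq Z]

/-- The random map of one oracle answer: a compared state moves to the winner, all other states
stay where they are. -/
def move (c : Comparison Z) (x : Z) : Z :=
  if x ∉ c.set ∨ x = c.winner then x else c.winner

/-- The stochastic flow `F_{-t}` from time `-t` to time `0`; the answer `c t` is the one used at
time `-(t + 1)`, and it is appended in the past. -/
def flow (c : ℕ → Comparison Z) : ℕ → Z → Z
  | 0, x => x
  | t + 1, x => flow c t (move (c t) x)

/-- All walks started at time `-t` are in the same state at time `0`. -/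
def Coalesced (c : ℕ → Comparison Z) (t : ℕ) : Prop :=
  ∀ x y, flow c t x = flow c t y

/-- The number of oracle answers that the algorithm draws before it stops: the first `t` at which
the flow has coalesced (`⊤` if there is none). -/
def numSamples (c : ℕ → Comparison Z) : ℕ∞ :=
  ⨅ (t : ℕ) (_ : Coalesced c t), (t : ℕ∞)

/-- The output `F_{-N}(1)`, with `N` the number of samples drawn (only meaningful when `N` is
finite). The first state of `Fin n` is called `0`. -/
def output {n : ℕ} [NeZero n] (c : ℕ → Comparison (Fin n)) : Fin n :=
  flow c (numSamples c).toNat 0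

end Flow

/-! ### A machine model with a step count

Imperative programs over natural-number variables (from a set `V`) and one array, with an
oracle that hands out triples of numbers. The only arithmetic is adding one, and every elementary
command and every test costs one step, so that the unit cost is that of a standard
random-access machine. -/

/-- Tests of a branch or a loop. -/
inductive Test (V : Type) : Type
  | eq (a b : V)
  | lt (a b : V)

/-- Programs. -/
inductive Cmd (V : Type) : Type
  | skip
  /-- `a := k` -/
  | const (a : V) (k : ℕ)
  /-- `a := a + 1` -/
  | succ (a : V)
  /-- `a := b` -/
  | copy (a b : V)
  /-- `a := F[b]` -/
  | load (a b : V)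
  /-- `F[a] := b` -/
  | store (a b : V)
  /-- `(i, j, w) :=` next oracle answer -/
  | sample (i j w : V)
  | seq (p q : Cmd V)
  | ite (t : Test V) (p q : Cmd V)
  | while (t : Test V) (p : Cmd V)

/-- Memory of the machine, and the number of oracle answers that it has drawn. -/
structure State (V : Type) where
  var : V → ℕ
  arr : ℕ → ℕ
  drawn : ℕ

/-- Truth of a test. -/
def Test.Holds {V : Type} (s : State V) : Test V → Prop
  | .eq a b => s.var a = s.var b
  | .lt a b => s.var a < s.var b

/-- Assignment to a variable. -/
def State.set {V : Type} [DecidableEq V] (s : State V) (a : V) (k : ℕ) : State V :=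
  { s with var := Function.update s.var a k }

/-- `Exec o p s s' k`: with oracle answers `o 0, o 1, …`, the program `p` started in `s` halts in
`s'` after exactly `k` steps. -/
inductive Exec {V : Type} [DecidableEq V] (o : ℕ → ℕ × ℕ × ℕ) :
    Cmd V → State V → State V → ℕ → Prop
  | skip (s) : Exec o .skip s s 1
  | const (s a k) : Exec o (.const a k) s (s.set a k) 1
  | succ (s a) : Exec o (.succ a) s (s.set a (s.var a + 1)) 1
  | copy (s a b) : Exec o (.copy a b) s (s.set a (s.var b)) 1
  | load (s a b) : Exec o (.load a b) s (s.set a (s.arr (s.var b))) 1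
  | store (s a b) :
      Exec o (.store a b) s { s with arr := Function.update s.arr (s.var a) (s.var b) } 1
  | sample (s i j w) :
      Exec o (.sample i j w) s
        { (((s.set i (o s.drawn).1).set j (o s.drawn).2.1).set w (o s.drawn).2.2) with
          drawn := s.drawn + 1 } 1
  | seq {p q s s' s'' k l} (hp : Exec o p s s' k) (hq : Exec o q s' s'' l) :
      Exec o (.seq p q) s s'' (k + l)
  | ite_true {t p q s s' k} (ht : t.Holds s) (hp : Exec o p s s' k) :
      Exec o (.ite t p q) s s' (1 + k)
  | ite_false {t p q s s' k} (ht : ¬ t.Holds s) (hq : Exec o q s s' k) :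
      Exec o (.ite t p q) s s' (1 + k)
  | while_false {t p s} (ht : ¬ t.Holds s) : Exec o (.while t p) s s 1
  | while_true {t p s s' s'' k l} (ht : t.Holds s) (hp : Exec o p s s' k)
      (hw : Exec o (.while t p) s' s'' l) : Exec o (.while t p) s s'' (1 + k + l)

/-- The machine is deterministic: final state and number of steps are determined. -/
theorem Exec.unique {V : Type} [DecidableEq V] {o : ℕ → ℕ × ℕ × ℕ} {p : Cmd V}
    {s s₁ s₂ : State V} {k₁ k₂ : ℕ} (h₁ : Exec o p s s₁ k₁) (h₂ : Exec o p s s₂ k₂) :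
    s₁ = s₂ ∧ k₁ = k₂ := by
  induction h₁ generalizing s₂ k₂ with
  | seq hp hq ihp ihq =>
    cases h₂ with
    | seq hp' hq' =>
      obtain ⟨rfl, rfl⟩ := ihp hp'
      obtain ⟨rfl, rfl⟩ := ihq hq'
      exact ⟨rfl, rfl⟩
  | ite_true ht hp ih =>
    cases h₂ with
    | ite_true _ hp' =>
      obtain ⟨rfl, rfl⟩ := ih hp'
      exact ⟨rfl, rfl⟩
    | ite_false hf _ => exact absurd ht hf
  | ite_false hf hp ih =>
    cases h₂ with
    | ite_true ht _ => exact absurd ht hf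
    | ite_false _ hp' =>
      obtain ⟨rfl, rfl⟩ := ih hp'
      exact ⟨rfl, rfl⟩
  | while_false hf =>
    cases h₂ with
    | while_false _ => exact ⟨rfl, rfl⟩
    | while_true ht _ _ => exact absurd ht hf
  | while_true ht hp hw ihp ihw =>
    cases h₂ with
    | while_false hf => exact absurd ht hf
    | while_true _ hp' hw' =>
      obtain ⟨rfl, rfl⟩ := ihp hp'
      obtain ⟨rfl, rfl⟩ := ihw hw'
      exact ⟨rfl, rfl⟩
  | _ => cases h₂; exact ⟨rfl, rfl⟩

/-! ### The sampling algorithm as a program -/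

/-- The variables of the sampling program: `n` holds the size of the state space (the input),
`x` is a loop counter, `i`, `j`, `w` hold the current comparison, `u`, `v` are scratch,
`zero` is constantly `0`, `coal` is the coalescence flag and `out` holds the output. -/
inductive Var : Type
  | n | x | i | j | w | u | v | zero | coal | out
  deriving DecidableEq

/-- `for x = 0, …, n - 1 do p` -/
def forEach (p : Cmd Var) : Cmd Var :=
  .seq (.const .x 0) (.while (.lt .x .n) (.seq p (.succ .x)))

/-- `F[x] := x` for all states `x` -/
def initArray : Cmd Var := forEach (.store .x .x)

/-- `coal := 1` if the array `F` is constant on the states, `coal := 0` otherwise -/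
def checkCoalescence : Cmd Var :=
  .seq (.const .coal 1) <| .seq (.load .u .zero) <|
    forEach (.seq (.load .v .x) (.ite (.eq .v .u) .skip (.const .coal 0)))

/-- Draw a comparison `(i, j, w)`; then, for every state `x`: leave `F[x]` unchanged if
`x ∉ {i, j}` or `x = w`, and put `F[x] := F[w]` otherwise. (The entry `F[w]` never changes in this
loop, so the update can be done in place.) -/
def drawAndUpdate : Cmd Var :=
  .seq (.sample .i .j .w) <|
    forEach <| .ite (.eq .x .w) .skip <|
      .ite (.eq .x .i) (.seq (.load .v .w) (.store .x .v)) <|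
        .ite (.eq .x .j) (.seq (.load .v .w) (.store .x .v)) .skip

/-- Coupling from the past with the comparisons of a local sampling scheme; one program for all
sizes of the state space. -/
def exactSampler : Cmd Var :=
  .seq (.const .zero 0) <| .seq initArray <| .seq checkCoalescence <|
    .seq (.while (.eq .coal .zero) (.seq drawAndUpdate checkCoalescence)) <|
      .load .out .zero

/-- The tape `o` presents the comparisons `c` to the machine: its `t`-th entry is `(i, j, w)`,
where `{i, j}` is the compared pair, in any order, and `w` is the winner. -/
def Presents {n : ℕ} (o : ℕ → ℕ × ℕ × ℕ) (c : ℕ → Comparison (Fin n)) : Prop :=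
  ∀ t, ∃ i j : Fin n, (c t).set = {i, j} ∧ o t = (i.val, j.val, (c t).winner.val)

end CFTP

end

/-! Run the grand coupling from two states and let `u` be the probability that the two walks still
differ after `t` samples. This function is zero on the diagonal, and one more sample acts on it
through the linear operator `pairStep`. The core of the proof is that `pairStep` contracts the
second moment of such functions under the product measure of `D` with itself by a factor `1 - γ /
n`, where `γ` is the absolute spectral gap.

Conditioned on the compared pair, the operator averages over that pair. The lost second moment is
exactly a Dirichlet term in each of the two coordinates (`sum_pairAvg_sq`); the vanishing on the
diagonal makes this exact even when both coordinates lie in the pair. Averaging over pairs, the loss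
is at least the sum of the Dirichlet forms of `u` in each variable. The Poincaré inequality turns
these into conditional variances, Efron–Stein bounds their sum below by the full variance, and
Cauchy–Schwarz off the diagonal shows that this variance is at least a fraction `∑ D² ≥ 1 / n` of
the second moment.

The Poincaré constant is the absolute gap because the chain is positive semidefinite: it is a
mixture of conditional expectations, so `|λₙ| ≤ λ₂` (`absSpectralGap_walk`). Passing from the
weighted second moment to single pairs, followed by a union bound, costs a power of the inverse
minimal probability and yields the tail bound `measureReal_not_coalesced_le`. Almost sure
termination and the sample bound follow.

The output law is the usual argument for coupling from the past: once the flow has coalesced its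
value never changes, and a start drawn from the stationary `D` has law `D` at every time, so the
error is at most the probability of not having coalesced. For the running time, one sample lowers
the number of values of the flow by at most one. Hence `n ≤ N + 1`, and step counts polynomial in
`n` and `N` are polynomial in `N`. -/

noncomputable section

namespace CFTP

/-! ### Contraction of the killed pair process -/

section Contraction

variable {ι : Type*} [Fintype ι]

/-- Jensen's inequality for finite weights of total mass one. -/
theorem sq_sum_mul_le {κ : Type*} [Fintype κ] {w : κ → ℝ} (f : κ → ℝ) (hw : ∀ a, 0 ≤ w a)
    (h1 : ∑ a, w a = 1) : (∑ a, w a * f a) ^ 2 ≤ ∑ a, w a * f a ^ 2 := by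
  have := Finset.sum_sq_le_sum_mul_sum_of_sq_le_mul Finset.univ (r := fun a => w a * f a)
    (fun a _ => hw a) (g := fun a => w a * f a ^ 2)
    (fun a _ => mul_nonneg (hw a) (sq_nonneg _)) (fun a _ => le_of_eq (by ring))
  rwa [h1, one_mul] at this

/-- The variance of `g` under the weights `D`. -/
def wVar (D g : ι → ℝ) : ℝ := ∑ x, D x * (g x - ∑ z, D z * g z) ^ 2

theorem wVar_eq {D : ι → ℝ} (hD1 : ∑ x, D x = 1) (g : ι → ℝ) :
    wVar D g = ∑ x, D x * g x ^ 2 - (∑ x, D x * g x) ^ 2 := by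
  rw [wVar]
  generalize hm : ∑ z, D z * g z = m
  have : ∀ x, D x * (g x - m) ^ 2 = D x * g x ^ 2 - 2 * m * (D x * g x) + D x * m ^ 2 :=
    fun x => by ring
  simp_rw [this, Finset.sum_add_distrib, Finset.sum_sub_distrib, ← Finset.mul_sum, hm,
    ← Finset.sum_mul, hD1]
  ring

/-- The Efron–Stein inequality for functions of two independent variables. -/
theorem efron_stein {D : ι → ℝ} (hD : ∀ x, 0 ≤ D x) (hD1 : ∑ x, D x = 1) (u : ι → ι → ℝ) :
    (∑ x, ∑ y, D x * D y * u x y ^ 2) - (∑ x, ∑ y, D x * D y * u x y) ^ 2 ≤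
      ∑ y, D y * wVar D (fun x => u x y) + ∑ x, D x * wVar D (u x) := by
  have h1 : ∑ x, D x * wVar D (u x) =
      (∑ x, ∑ y, D x * D y * u x y ^ 2) - ∑ x, D x * (∑ y, D y * u x y) ^ 2 := by
    simp_rw [wVar_eq hD1, mul_sub, Finset.sum_sub_distrib, Finset.mul_sum, mul_assoc]
  have h2 := wVar_eq hD1 (fun x => ∑ y, D y * u x y)
  -- `h1` and `h2` give the law of total variance; what remains is convexity: the variance of an
  -- average of functions is at most the average of their variances.
  have h3 : wVar D (fun x => ∑ y, D y * u x y) ≤ ∑ y, D y * wVar D (fun x => u x y) := by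
    simp_rw [wVar, Finset.mul_sum]
    refine le_of_le_of_eq (Finset.sum_le_sum fun x _ => ?_) Finset.sum_comm
    have e : ∑ y, D y * u x y - ∑ z, ∑ y, D z * (D y * u z y) =
        ∑ y, D y * (u x y - ∑ z, D z * u z y) := by
      simp_rw [mul_sub, Finset.sum_sub_distrib, Finset.mul_sum]
      rw [Finset.sum_comm (f := fun y z => D y * (D z * u z y))]
      congr 1
      exact Finset.sum_congr rfl fun a _ => Finset.sum_congr rfl fun b _ => by ring
    rw [e]
    calc _ ≤ D x * ∑ y, D y * (u x y - ∑ z, D z * u z y) ^ 2 :=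
          mul_le_mul_of_nonneg_left (sq_sum_mul_le _ hD hD1) (hD x)
      _ = _ := by
          rw [Finset.mul_sum]
          exact Finset.sum_congr rfl fun y _ => by ring
  have e2 : (∑ x, ∑ y, D x * D y * u x y) = ∑ x, D x * ∑ y, D y * u x y := by
    simp_rw [Finset.mul_sum, mul_assoc]
  rw [h1, e2]
  linarith

variable [DecidableEq ι]

/-- The map sending the loser `b` to the winner `a`. -/
def sendTo (a b x : ι) : ι := if x = b then a else x

/-- The probability that the pair `{a, b}` is compared and won by `a`. -/
def winRate (q : ι → ι → ℝ) (D : ι → ℝ) (a b : ι) : ℝ := q a b * (D a / (D a + D b))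

/-- The averaging operator of the grand coupling, on functions of two states. -/
def pairStep (q : ι → ι → ℝ) (D : ι → ℝ) (u : ι → ι → ℝ) (x y : ι) : ℝ :=
  ∑ a, ∑ b, winRate q D a b * u (sendTo a b x) (sendTo a b y)

/-- The averaging operator conditioned on comparing the pair `{a, b}`. -/
def pairAvg (D : ι → ℝ) (a b : ι) (u : ι → ι → ℝ) (x y : ι) : ℝ :=
  D a / (D a + D b) * u (sendTo a b x) (sendTo a b y)
    + D b / (D a + D b) * u (sendTo b a x) (sendTo b a y)

/-- The Dirichlet form. -/
def energy (q : ι → ι → ℝ) (D : ι → ℝ) (g : ι → ℝ) : ℝ :=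
  1 / 2 * ∑ a, ∑ b, q a b * (D a * D b / (D a + D b) * (g a - g b) ^ 2)

theorem sum_eq_add_add_sum_erase_erase {a b : ι} (hab : a ≠ b) (f : ι → ℝ) :
    ∑ x, f x = f a + f b + ∑ x ∈ (Finset.univ.erase a).erase b, f x := by
  rw [← Finset.add_sum_erase _ f (Finset.mem_univ a),
    ← Finset.add_sum_erase _ f (Finset.mem_erase.2 ⟨hab.symm, Finset.mem_univ b⟩), add_assoc]

/-- Averaging over `{a, b}` changes only the rows and columns `a`, `b`. Outside the 2 × 2 block each
such line loses its two-point variance, as for a projection. The block itself is killed entirely,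
and its loss `D a * D b * (u a b ^ 2 + u b a ^ 2)` matches the Dirichlet terms because the diagonal
entries vanish. -/
theorem sum_pairAvg_sq {D : ι → ℝ} (hD : ∀ x, 0 < D x) {a b : ι} (hab : a ≠ b)
    {u : ι → ι → ℝ} (hu : ∀ x, u x x = 0) :
    ∑ x, ∑ y, D x * D y * pairAvg D a b u x y ^ 2 =
      (∑ x, ∑ y, D x * D y * u x y ^ 2)
        - (∑ y, D y * (D a * D b / (D a + D b) * (u a y - u b y) ^ 2)
          + ∑ x, D x * (D a * D b / (D a + D b) * (u x a - u x b) ^ 2)) := by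
  have hs : D a + D b ≠ 0 := (add_pos (hD a) (hD b)).ne'
  rw [eq_sub_iff_add_eq, ← eq_sub_iff_add_eq', ← Finset.sum_sub_distrib]
  simp_rw [← Finset.sum_sub_distrib]
  set G : ι → ι → ℝ := fun x y => D x * D y * u x y ^ 2 - D x * D y * pairAvg D a b u x y ^ 2
    with hG
  have hR : ∀ x ∈ (Finset.univ.erase a).erase b, x ≠ a ∧ x ≠ b := by
    intro x hx
    simp only [Finset.mem_erase, Finset.mem_univ, and_true] at hx
    exact ⟨hx.2, hx.1⟩
  have h1 : ∀ y ∈ (Finset.univ.erase a).erase b,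
      G a y + G b y = D y * (D a * D b / (D a + D b) * (u a y - u b y) ^ 2) := by
    intro y hy
    obtain ⟨ha, hb⟩ := hR y hy
    simp only [hG, pairAvg, sendTo, ha, hb, hab, hab.symm, if_true, if_false]
    field_simp
    ring
  have h2 : ∀ x ∈ (Finset.univ.erase a).erase b,
      G x a + G x b = D x * (D a * D b / (D a + D b) * (u x a - u x b) ^ 2) := by
    intro x hx
    obtain ⟨ha, hb⟩ := hR x hx
    simp only [hG, pairAvg, sendTo, ha, hb, hab, hab.symm, if_true, if_false]
    field_simp
    ring
  have h3 : ∀ x ∈ (Finset.univ.erase a).erase b, ∀ y ∈ (Finset.univ.erase a).erase b,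
      G x y = 0 := by
    intro x hx y hy
    obtain ⟨ha, hb⟩ := hR x hx
    obtain ⟨ha', hb'⟩ := hR y hy
    simp only [hG, pairAvg, sendTo, ha, hb, ha', hb', if_false]
    field_simp
    ring
  -- After the comparison both walks sit at the winner, so `pairAvg` is zero at all four entries of
  -- the block.
  have h4 : G a a + G a b + (G b a + G b b) =
      (D a * (D a * D b / (D a + D b) * (u a a - u b a) ^ 2)
        + D b * (D a * D b / (D a + D b) * (u a b - u b b) ^ 2))
      + (D a * (D a * D b / (D a + D b) * (u a a - u a b) ^ 2)
        + D b * (D a * D b / (D a + D b) * (u b a - u b b) ^ 2)) := by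
    simp only [hG, pairAvg, sendTo, hab, hab.symm, if_true, if_false, hu]
    field_simp
    ring
  have e1 : ∑ x, ∑ y, G x y = (G a a + G a b + (G b a + G b b))
      + ∑ y ∈ (Finset.univ.erase a).erase b, (G a y + G b y)
      + ∑ x ∈ (Finset.univ.erase a).erase b, (G x a + G x b) := by
    simp_rw [sum_eq_add_add_sum_erase_erase hab]
    rw [Finset.sum_add_distrib (f := fun x => G x a + G x b),
      Finset.sum_eq_zero (fun x hx => Finset.sum_eq_zero (h3 x hx)),
      Finset.sum_add_distrib (f := fun y => G a y)]
    ring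
  rw [show (∑ x, ∑ y, (D x * D y * u x y ^ 2 - D x * D y * pairAvg D a b u x y ^ 2)) =
    ∑ x, ∑ y, G x y from rfl, e1, h4, Finset.sum_congr rfl h1, Finset.sum_congr rfl h2,
    sum_eq_add_add_sum_erase_erase hab (fun y => D y * (D a * D b / (D a + D b) * _)),
    sum_eq_add_add_sum_erase_erase hab (fun x => D x * (D a * D b / (D a + D b) * (u x a - u x b) ^ 2))]
  ring

/-- Summing over ordered pairs counts each unordered pair twice, whence the weight `q a b / 2`. -/
theorem pairStep_eq {q : ι → ι → ℝ} (hq : ∀ a b, q a b = q b a) (D : ι → ℝ)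
    (u : ι → ι → ℝ) (x y : ι) :
    pairStep q D u x y = ∑ a, ∑ b, q a b / 2 * pairAvg D a b u x y := by
  have h : ∑ a, ∑ b, q a b / 2 * pairAvg D a b u x y =
      1 / 2 * pairStep q D u x y + 1 / 2 * ∑ a, ∑ b, winRate q D b a *
        u (sendTo b a x) (sendTo b a y) := by
    simp only [pairStep, Finset.mul_sum, ← Finset.sum_add_distrib]
    refine Finset.sum_congr rfl fun a _ => Finset.sum_congr rfl fun b _ => ?_
    rw [pairAvg, winRate, winRate, hq b a, add_comm (D b)]
    ring
  rw [h, Finset.sum_comm]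
  simp only [pairStep]
  ring

/-- Jensen over the random pair, then the exact identity `sum_pairAvg_sq` for each pair. -/
theorem sum_pairStep_sq_le {q : ι → ι → ℝ} {D : ι → ℝ} (hD : ∀ x, 0 < D x)
    (hq : ∀ a b, q a b = q b a) (hq0 : ∀ a b, 0 ≤ q a b) (hqd : ∀ a, q a a = 0)
    (hq1 : ∑ a, ∑ b, q a b = 2) {u : ι → ι → ℝ} (hu : ∀ x, u x x = 0) :
    ∑ x, ∑ y, D x * D y * pairStep q D u x y ^ 2 ≤
      (∑ x, ∑ y, D x * D y * u x y ^ 2)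
        - (∑ y, D y * energy q D (fun x => u x y) + ∑ x, D x * energy q D (u x)) := by
  have hw1 : ∑ a, ∑ b, q a b / 2 = 1 := by
    simp_rw [← Finset.sum_div]; rw [hq1]; norm_num
  have key : ∀ a b, q a b / 2 * ∑ x, ∑ y, D x * D y * pairAvg D a b u x y ^ 2 =
      q a b / 2 * ((∑ x, ∑ y, D x * D y * u x y ^ 2)
        - (∑ y, D y * (D a * D b / (D a + D b) * (u a y - u b y) ^ 2)
          + ∑ x, D x * (D a * D b / (D a + D b) * (u x a - u x b) ^ 2))) := by
    intro a b
    rcases eq_or_ne a b with rfl | hab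
    · simp [hqd]
    · rw [sum_pairAvg_sq hD hab hu]
  calc ∑ x, ∑ y, D x * D y * pairStep q D u x y ^ 2
      ≤ ∑ x, ∑ y, D x * D y * ∑ a, ∑ b, q a b / 2 * pairAvg D a b u x y ^ 2 := by
        refine Finset.sum_le_sum fun x _ => Finset.sum_le_sum fun y _ =>
          mul_le_mul_of_nonneg_left ?_ (mul_pos (hD x) (hD y)).le
        rw [pairStep_eq hq]
        have := sq_sum_mul_le (w := fun p : ι × ι => q p.1 p.2 / 2)
          (fun p => pairAvg D p.1 p.2 u x y) (fun p => div_nonneg (hq0 _ _) zero_le_two)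
          (by rw [Fintype.sum_prod_type, hw1])
        simpa only [Fintype.sum_prod_type] using this
    _ = ∑ a, ∑ b, q a b / 2 * ∑ x, ∑ y, D x * D y * pairAvg D a b u x y ^ 2 := by
        have := Finset.sum_comm (s := (Finset.univ : Finset (ι × ι)))
          (t := (Finset.univ : Finset (ι × ι)))
          (f := fun p r => D p.1 * D p.2 * (q r.1 r.2 / 2 * pairAvg D r.1 r.2 u p.1 p.2 ^ 2))
        simp only [Fintype.sum_prod_type] at this
        simp only [Finset.mul_sum]
        rw [this]
        refine Finset.sum_congr rfl fun a _ => Finset.sum_congr rfl fun b _ =>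
          Finset.sum_congr rfl fun x _ => Finset.sum_congr rfl fun y _ => by ring
    _ = _ := by
        have comm : ∀ F : ι → ι → ι → ℝ, ∑ y, D y * (1 / 2 * ∑ a, ∑ b, q a b * F y a b) =
            ∑ a, ∑ b, q a b / 2 * ∑ y, D y * F y a b := by
          intro F
          simp only [Finset.mul_sum]
          rw [Finset.sum_comm]
          refine Finset.sum_congr rfl fun a _ => ?_
          rw [Finset.sum_comm]
          refine Finset.sum_congr rfl fun b _ => Finset.sum_congr rfl fun y _ => by ring
        simp only [key, mul_sub, mul_add, Finset.sum_sub_distrib, Finset.sum_add_distrib,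
          ← Finset.sum_mul, hw1, one_mul, energy]
        rw [comm (fun y a b => D a * D b / (D a + D b) * (u a y - u b y) ^ 2),
          comm (fun x a b => D a * D b / (D a + D b) * (u x a - u x b) ^ 2)]

/-- A function vanishing on the diagonal has variance at least `∑ D² ≥ 1 / card` of its second
moment. -/
theorem le_sub_sq_of_diag_zero [Nonempty ι] {D : ι → ℝ} (hD : ∀ x, 0 ≤ D x)
    (hD1 : ∑ x, D x = 1) {u : ι → ι → ℝ} (hu : ∀ x, u x x = 0) :
    (∑ x, ∑ y, D x * D y * u x y ^ 2) / Fintype.card ι ≤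
      (∑ x, ∑ y, D x * D y * u x y ^ 2) - (∑ x, ∑ y, D x * D y * u x y) ^ 2 := by
  set U := ∑ x, ∑ y, D x * D y * u x y ^ 2 with hU
  have hU0 : 0 ≤ U := Finset.sum_nonneg fun x _ => Finset.sum_nonneg fun y _ =>
    mul_nonneg (mul_nonneg (hD x) (hD y)) (sq_nonneg _)
  have hdiag : 1 / (Fintype.card ι : ℝ) ≤ ∑ x, D x ^ 2 := by
    have := sq_sum_le_card_mul_sum_sq (s := Finset.univ) (f := D)
    rw [hD1] at this
    rw [div_le_iff₀ (by exact_mod_cast Fintype.card_pos)]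
    simpa [mul_comm] using this
  have hoff : ∑ x, ∑ y, (if x = y then 0 else D x * D y) = 1 - ∑ x, D x ^ 2 := by
    have : ∀ x y, (if x = y then 0 else D x * D y) =
        D x * D y - (if x = y then D x * D y else 0) := by
      intro x y; split_ifs <;> ring
    simp_rw [this, Finset.sum_sub_distrib, ← Finset.mul_sum, hD1]
    simp [hD1, sq]
  -- Cauchy–Schwarz against the indicator of the off-diagonal, which has mass `1 - ∑ D²`.
  have hcs := Finset.sum_sq_le_sum_mul_sum_of_sq_le_mul (Finset.univ : Finset (ι × ι))
    (r := fun p => D p.1 * D p.2 * u p.1 p.2)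
    (f := fun p => if p.1 = p.2 then 0 else D p.1 * D p.2)
    (g := fun p => D p.1 * D p.2 * u p.1 p.2 ^ 2)
    (fun p _ => by split_ifs; exacts [le_rfl, mul_nonneg (hD _) (hD _)])
    (fun p _ => mul_nonneg (mul_nonneg (hD _) (hD _)) (sq_nonneg _))
    (fun p _ => by
      obtain ⟨x, y⟩ := p
      dsimp only
      split_ifs with h
      · subst h; simp [hu]
      · exact le_of_eq (by ring))
  simp only [Fintype.sum_prod_type] at hcs
  rw [hoff, ← hU] at hcs
  have := mul_le_mul_of_nonneg_right hdiag hU0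
  rw [one_div, inv_mul_eq_div] at this
  linarith

/-- Chain of bounds: loss ≥ Dirichlet forms ≥ `γ` times conditional variances ≥ `γ` times variance ≥
`γ / n` times second moment. -/
theorem sum_pairStep_sq_le_mul [Nonempty ι] {q : ι → ι → ℝ} {D : ι → ℝ} (hD : ∀ x, 0 < D x)
    (hD1 : ∑ x, D x = 1) (hq : ∀ a b, q a b = q b a) (hq0 : ∀ a b, 0 ≤ q a b)
    (hqd : ∀ a, q a a = 0) (hq1 : ∑ a, ∑ b, q a b = 2) {γ : ℝ} (hγ : 0 ≤ γ)
    (hgap : ∀ g, γ * wVar D g ≤ energy q D g) {u : ι → ι → ℝ} (hu : ∀ x, u x x = 0) :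
    ∑ x, ∑ y, D x * D y * pairStep q D u x y ^ 2 ≤
      (1 - γ / Fintype.card ι) * ∑ x, ∑ y, D x * D y * u x y ^ 2 := by
  have h1 := sum_pairStep_sq_le hD hq hq0 hqd hq1 hu
  have h2 := (le_sub_sq_of_diag_zero (fun x => (hD x).le) hD1 hu).trans
    (efron_stein (fun x => (hD x).le) hD1 u)
  have h3 : γ * (∑ y, D y * wVar D (fun x => u x y) + ∑ x, D x * wVar D (u x)) ≤
      ∑ y, D y * energy q D (fun x => u x y) + ∑ x, D x * energy q D (u x) := by
    rw [mul_add, Finset.mul_sum, Finset.mul_sum]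
    refine add_le_add (Finset.sum_le_sum fun y _ => ?_) (Finset.sum_le_sum fun y _ => ?_) <;>
    · rw [mul_left_comm]
      exact mul_le_mul_of_nonneg_left (hgap _) (hD y).le
  have h4 := mul_le_mul_of_nonneg_left h2 hγ
  have h5 : γ / Fintype.card ι * (∑ x, ∑ y, D x * D y * u x y ^ 2) =
    γ * ((∑ x, ∑ y, D x * D y * u x y ^ 2) / Fintype.card ι) := by ring
  rw [sub_mul, one_mul, h5]
  linarith

theorem pairStep_diag (q : ι → ι → ℝ) (D : ι → ℝ) {u : ι → ι → ℝ} (hu : ∀ x, u x x = 0) (x : ι) :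
    pairStep q D u x x = 0 := by
  simp [pairStep, hu]

theorem iterate_pairStep_diag (q : ι → ι → ℝ) (D : ι → ℝ) {u : ι → ι → ℝ}
    (hu : ∀ x, u x x = 0) (t : ℕ) (x : ι) : (pairStep q D)^[t] u x x = 0 := by
  induction t generalizing x with
  | zero => exact hu x
  | succ t ih => rw [Function.iterate_succ_apply']; exact pairStep_diag q D ih x

/-- Exponential decay of the pair process killed on the diagonal. -/
theorem iterate_pairStep_sq_le [Nonempty ι] {q : ι → ι → ℝ} {D : ι → ℝ} (hD : ∀ x, 0 < D x)
    (hD1 : ∑ x, D x = 1) (hq : ∀ a b, q a b = q b a) (hq0 : ∀ a b, 0 ≤ q a b)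
    (hqd : ∀ a, q a a = 0) (hq1 : ∑ a, ∑ b, q a b = 2) {γ : ℝ} (hγ : 0 ≤ γ) (hγ1 : γ ≤ 1)
    (hgap : ∀ g, γ * wVar D g ≤ energy q D g) {u : ι → ι → ℝ} (hu : ∀ x, u x x = 0) (t : ℕ) :
    ∑ x, ∑ y, D x * D y * (pairStep q D)^[t] u x y ^ 2 ≤
      (1 - γ / Fintype.card ι) ^ t * ∑ x, ∑ y, D x * D y * u x y ^ 2 := by
  have hc : 0 ≤ 1 - γ / Fintype.card ι := by
    rw [sub_nonneg, div_le_one (by exact_mod_cast Fintype.card_pos)]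
    exact hγ1.trans (by exact_mod_cast Fintype.card_pos)
  induction t with
  | zero => simp
  | succ t ih =>
    rw [Function.iterate_succ_apply', pow_succ', mul_assoc]
    exact (sum_pairStep_sq_le_mul hD hD1 hq hq0 hqd hq1 hγ hgap
      (iterate_pairStep_diag q D hu t)).trans (mul_le_mul_of_nonneg_left ih hc)

end Contraction

/-! ### The spectral gap of a reversible positive semidefinite chain -/

section SpectralGap

/-- For a symmetric operator with `0 ≤ T ≤ 1` whose fixed space is spanned by `v`: all
eigenvalues are nonnegative, the second one is less than one, and it bounds the Rayleigh quotient
on the orthogonal complement of `v`. -/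
theorem symmetric_eigenvalues_bounds {E : Type*} [NormedAddCommGroup E] [InnerProductSpace ℝ E]
    [FiniteDimensional ℝ E] {T : E →ₗ[ℝ] E} (hT : T.IsSymmetric) {N : ℕ}
    (hN : Module.finrank ℝ E = N) (h2 : 1 < N) (h0 : ∀ f, 0 ≤ inner ℝ (T f) f)
    (h1 : ∀ f, inner ℝ (T f) f ≤ inner ℝ f f) {v : E} (hv : v ≠ 0) (hTv : T v = v)
    (hfix : ∀ f, T f = f → ∃ c : ℝ, f = c • v) :
    (∀ i, 0 ≤ hT.eigenvalues hN i) ∧ hT.eigenvalues hN ⟨1, h2⟩ < 1 ∧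
      ∀ f, inner ℝ v f = 0 → inner ℝ (T f) f ≤ hT.eigenvalues hN ⟨1, h2⟩ * inner ℝ f f := by
  set b := hT.eigenvectorBasis hN with hb
  set l := hT.eigenvalues hN with hl
  have hTb : ∀ i, T (b i) = l i • b i := hT.apply_eigenvectorBasis hN
  have hbb : ∀ i, inner ℝ (b i) (b i) = (1 : ℝ) := fun i => by
    rw [real_inner_self_eq_norm_sq, b.orthonormal.1 i, one_pow]
  have hlr : ∀ i, inner ℝ (T (b i)) (b i) = l i := fun i => by
    rw [hTb, real_inner_smul_left, hbb, mul_one]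
  have hanti : Antitone l := hT.eigenvalues_antitone hN
  have hl1 : ∀ i, l i ≤ 1 := fun i => by rw [← hlr, ← hbb i]; exact h1 _
  have hcoef : ∀ f i, inner ℝ (T f) (b i) = l i * inner ℝ f (b i) := fun f i => by
    rw [hT f (b i), hTb, real_inner_smul_right]
  have hz : l ⟨0, by omega⟩ = 1 := by
    obtain ⟨i, hi⟩ : ∃ i, inner ℝ v (b i) ≠ (0 : ℝ) := by
      by_contra! h
      apply hv
      rw [← b.sum_repr' v]
      exact Finset.sum_eq_zero fun i _ => by rw [real_inner_comm, h, zero_smul]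
    have := hcoef v i
    rw [hTv] at this
    have hi1 : l i = 1 := by
      have h3 : (l i - 1) * inner ℝ v (b i) = 0 := by linarith
      rcases mul_eq_zero.1 h3 with h | h
      · linarith
      · exact absurd h hi
    exact le_antisymm (hl1 _) (hi1 ▸ hanti (Fin.mk_le_of_le_val (Nat.zero_le _)))
  -- The top eigenvector is a multiple of `v`. A second eigenvalue `1` would give a fixed vector
  -- orthogonal to it, and a vector orthogonal to `v` has no top component.
  obtain ⟨c, hc⟩ := hfix (b ⟨0, by omega⟩) (by rw [hTb, hz, one_smul])
  have hc0 : c ≠ 0 := by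
    rintro rfl
    have := hbb ⟨0, by omega⟩
    rw [hc] at this
    simp at this
  refine ⟨fun i => hlr i ▸ h0 _, lt_of_le_of_ne (hl1 _) fun h => ?_, fun f hf => ?_⟩
  · obtain ⟨c', hc'⟩ := hfix (b ⟨1, h2⟩) (by rw [hTb, h, one_smul])
    have horth : inner ℝ (b ⟨0, by omega⟩) (b ⟨1, h2⟩) = (0 : ℝ) :=
      b.orthonormal.2 (by simp [Fin.ext_iff])
    have h11 := hbb ⟨1, h2⟩
    rw [hc, hc', real_inner_smul_left, real_inner_smul_right] at horth
    rw [hc', real_inner_smul_left, real_inner_smul_right] at h11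
    rcases mul_eq_zero.1 horth with h | h
    · exact hc0 h
    · rw [h, mul_zero] at h11; exact zero_ne_one h11
  · have e1 : inner ℝ (T f) f = ∑ i, l i * inner ℝ f (b i) ^ 2 := by
      rw [← b.sum_inner_mul_inner]
      refine Finset.sum_congr rfl fun i _ => ?_
      rw [hcoef, real_inner_comm f (b i)]; ring
    have e2 : inner ℝ f f = ∑ i, inner ℝ f (b i) ^ 2 := by
      rw [← b.sum_inner_mul_inner]
      refine Finset.sum_congr rfl fun i _ => ?_
      rw [real_inner_comm f (b i)]; ring
    rw [e1, e2, Finset.mul_sum]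
    refine Finset.sum_le_sum fun i _ => ?_
    by_cases hi : i = ⟨0, by omega⟩
    · subst hi
      rw [hc, real_inner_smul_right, real_inner_comm, hf]; simp
    · refine mul_le_mul_of_nonneg_right (hanti ?_) (sq_nonneg _)
      rw [Fin.le_def]
      have : i.val ≠ 0 := fun h => hi (Fin.ext h)
      change 1 ≤ i.val
      omega

theorem eigenvalueDesc_eq {n : ℕ} {P A : Matrix (Fin n) (Fin n) ℝ} (hA : A.IsHermitian)
    (h : P.charpoly = A.charpoly) {k : ℕ} (hk : k < Fintype.card (Fin n)) :
    eigenvalueDesc P k = hA.eigenvalues₀ ⟨k, hk⟩ := by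
  have := hA.sort_roots_charpoly_eq_eigenvalues₀
  rw [show (RCLike.re : ℝ → ℝ) = id from rfl, Multiset.map_id] at this
  rw [eigenvalueDesc, h]
  erw [this]
  rw [List.getD_eq_getElem _ _ (by simpa using hk), List.getElem_ofFn]

/-- The single-walk transition matrix with jump rates `winRate`. -/
def walk {ι : Type*} [Fintype ι] [DecidableEq ι] (q : ι → ι → ℝ) (D : ι → ℝ) : Matrix ι ι ℝ :=
  fun x y => if x = y then 1 - ∑ z ∈ Finset.univ.erase x, winRate q D z x else winRate q D y x

variable {ι : Type*} [Fintype ι] {q : ι → ι → ℝ} {D : ι → ℝ}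

theorem energy_nonneg (hD : ∀ x, 0 < D x) (hq0 : ∀ a b, 0 ≤ q a b) (g : ι → ℝ) :
    0 ≤ energy q D g :=
  mul_nonneg (by norm_num) <| Finset.sum_nonneg fun a _ => Finset.sum_nonneg fun b _ =>
    mul_nonneg (hq0 a b) (mul_nonneg (div_nonneg (mul_pos (hD a) (hD b)).le
      (add_pos (hD a) (hD b)).le) (sq_nonneg _))

theorem energy_sub_const (g : ι → ℝ) (c : ℝ) : energy q D (fun x => g x - c) = energy q D g := by
  simp [energy]

variable [DecidableEq ι]

theorem walk_sum (g : ι → ℝ) (x : ι) :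
    ∑ y, walk q D x y * g y = g x + ∑ y, winRate q D y x * (g y - g x) := by
  rw [← Finset.add_sum_erase _ _ (Finset.mem_univ x),
    ← Finset.add_sum_erase _ (fun y => winRate q D y x * (g y - g x)) (Finset.mem_univ x)]
  have : ∀ y ∈ Finset.univ.erase x, walk q D x y * g y = winRate q D y x * g y := by
    intro y hy
    rw [walk, if_neg (Finset.ne_of_mem_erase hy).symm]
  rw [Finset.sum_congr rfl this, walk, if_pos rfl]
  simp_rw [mul_sub, Finset.sum_sub_distrib, ← Finset.sum_mul]
  ring

theorem walk_reversible (hq : ∀ a b, q a b = q b a) (x y : ι) :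
    D x * walk q D x y = D y * walk q D y x := by
  rcases eq_or_ne x y with rfl | h
  · rfl
  · rw [walk, walk, if_neg h, if_neg h.symm, winRate, winRate, hq y x, add_comm (D y)]
    ring

/-- The quadratic form of the chain in `L²(D)` is the squared norm minus the Dirichlet form; this
transfers spectral questions to `energy`. -/
theorem sum_mul_walk (hq : ∀ a b, q a b = q b a) (g : ι → ℝ) :
    ∑ x, D x * g x * ∑ y, walk q D x y * g y = ∑ x, D x * g x ^ 2 - energy q D g := by
  set c : ι → ι → ℝ := fun a b => q a b * (D a * D b / (D a + D b)) with hc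
  have hcs : ∀ a b, c a b = c b a := fun a b => by
    rw [hc]; dsimp only; rw [hq, mul_comm (D a), add_comm (D a)]
  have e1 : ∑ x, D x * g x * ∑ y, walk q D x y * g y =
      ∑ x, D x * g x ^ 2 + ∑ x, ∑ y, c x y * (g x * g y - g x ^ 2) := by
    rw [← Finset.sum_add_distrib]
    refine Finset.sum_congr rfl fun x _ => ?_
    rw [walk_sum, mul_add, Finset.mul_sum]
    congr 1
    · ring
    · refine Finset.sum_congr rfl fun y _ => ?_
      rw [hc, winRate]; dsimp only; rw [hq x y, add_comm (D x)]; ring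
  have e2 : energy q D g = -∑ x, ∑ y, c x y * (g x * g y - g x ^ 2) := by
    have e3 : ∑ x, ∑ y, c x y * g x ^ 2 = ∑ x, ∑ y, c x y * g y ^ 2 := by
      rw [Finset.sum_comm]
      refine Finset.sum_congr rfl fun x _ => Finset.sum_congr rfl fun y _ => by rw [hcs]
    have e4 : energy q D g = 1 / 2 * (∑ x, ∑ y, c x y * g x ^ 2 + ∑ x, ∑ y, c x y * g y ^ 2)
        - ∑ x, ∑ y, c x y * (g x * g y) := by
      rw [energy]
      simp only [Finset.mul_sum, ← Finset.sum_add_distrib, ← Finset.sum_sub_distrib]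
      refine Finset.sum_congr rfl fun x _ => Finset.sum_congr rfl fun y _ => by
        rw [hc]; ring
    rw [e4, ← e3]
    simp only [mul_sub, Finset.sum_sub_distrib]
    ring
  rw [e1, e2]; ring

/-- This is positive semidefiniteness of the chain. For one pair, `D a * D b * (g a - g b) ^ 2`
equals `(D a + D b) * (D a * g a ^ 2 + D b * g b ^ 2)` minus the square of `D a * g a + D b * g b`;
then average over pairs. -/
theorem energy_le (hD : ∀ x, 0 < D x) (hq0 : ∀ a b, 0 ≤ q a b) (hqd : ∀ a, q a a = 0)
    (hq1 : ∑ a, ∑ b, q a b = 2) (g : ι → ℝ) : energy q D g ≤ ∑ x, D x * g x ^ 2 := by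
  have key : ∀ a b, q a b * (D a * D b / (D a + D b) * (g a - g b) ^ 2) ≤
      q a b * ∑ x, D x * g x ^ 2 := by
    intro a b
    rcases eq_or_ne a b with rfl | hab
    · simp [hqd]
    refine mul_le_mul_of_nonneg_left ?_ (hq0 a b)
    have hs := add_pos (hD a) (hD b)
    have h1 : D a * D b / (D a + D b) * (g a - g b) ^ 2 ≤ D a * g a ^ 2 + D b * g b ^ 2 := by
      rw [div_mul_eq_mul_div, div_le_iff₀ hs]
      nlinarith [sq_nonneg (D a * g a + D b * g b)]
    refine h1.trans ?_
    rw [sum_eq_add_add_sum_erase_erase hab]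
    exact le_add_of_nonneg_right (Finset.sum_nonneg fun x _ => mul_nonneg (hD x).le (sq_nonneg _))
  calc energy q D g ≤ 1 / 2 * ∑ a, ∑ b, q a b * ∑ x, D x * g x ^ 2 :=
        mul_le_mul_of_nonneg_left (Finset.sum_le_sum fun a _ => Finset.sum_le_sum fun b _ =>
          key a b) (by norm_num)
    _ = _ := by simp_rw [← Finset.sum_mul]; rw [hq1]; ring

/-- Conjugation by `√D` makes the chain symmetric without changing its characteristic polynomial.
Semidefiniteness makes the absolute value of the last eigenvalue harmless, so the absolute gap is `1
- λ₂`, the Poincaré constant. -/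
theorem absSpectralGap_walk {n : ℕ} (hn : 1 < n) {q : Fin n → Fin n → ℝ} {D : Fin n → ℝ}
    (hD : ∀ x, 0 < D x) (hD1 : ∑ x, D x = 1) (hq : ∀ a b, q a b = q b a)
    (hq0 : ∀ a b, 0 ≤ q a b) (hqd : ∀ a, q a a = 0) (hq1 : ∑ a, ∑ b, q a b = 2)
    (hconn : ∀ g, energy q D g = 0 → ∃ c : ℝ, ∀ x, g x = c) :
    0 < absSpectralGap (walk q D) ∧ absSpectralGap (walk q D) ≤ 1 ∧
      ∀ g, absSpectralGap (walk q D) * wVar D g ≤ energy q D g := by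
  set s : Fin n → ℝ := fun x => √(D x) with hs
  have hs0 : ∀ x, s x ≠ 0 := fun x => (Real.sqrt_pos.2 (hD x)).ne'
  have hss : ∀ x, s x * s x = D x := fun x => Real.mul_self_sqrt (hD x).le
  set A : Matrix (Fin n) (Fin n) ℝ := fun x y => s x * walk q D x y * (s y)⁻¹ with hA'
  have hA : A.IsHermitian := by
    ext x y
    change s y * walk q D y x * (s x)⁻¹ = s x * walk q D x y * (s y)⁻¹
    have := walk_reversible (D := D) hq x y
    rw [← hss, ← hss] at this
    have hx := hs0 x
    have hy := hs0 y
    field_simp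
    linarith
  have hchar : (walk q D).charpoly = A.charpoly := by
    let S : (Matrix (Fin n) (Fin n) ℝ)ˣ :=
      ⟨Matrix.diagonal s, Matrix.diagonal fun x => (s x)⁻¹,
        by simp [hs0], by simp [hs0]⟩
    rw [← Matrix.charpoly_units_conj S]
    refine congrArg _ (Eq.symm ?_)
    ext x y
    rw [← Matrix.coe_units_inv]
    change _ = (Matrix.diagonal s * walk q D * Matrix.diagonal fun x => (s x)⁻¹) x y
    rw [Matrix.mul_diagonal, Matrix.diagonal_mul]
  have hApp : ∀ (f : Fin n → ℝ) x, A.mulVec f x = s x * ∑ y, walk q D x y * (f y / s y) := by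
    intro f x
    simp only [Matrix.mulVec, dotProduct, hA', Finset.mul_sum]
    exact Finset.sum_congr rfl fun y _ => by ring
  have hquad : ∀ f : EuclideanSpace ℝ (Fin n), inner ℝ (Matrix.toEuclideanLin A f) f =
      inner ℝ f f - energy q D (fun x => f x / s x) := by
    intro f
    have h := sum_mul_walk (D := D) hq (fun x => f x / s x)
    rw [PiLp.inner_apply, PiLp.inner_apply]
    calc _ = ∑ x, D x * (f x / s x) * ∑ y, walk q D x y * (f y / s y) := by
          refine Finset.sum_congr rfl fun x _ => ?_
          simp only [RCLike.inner_apply, conj_trivial, Matrix.toLpLin_apply, hApp]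
          rw [← hss x]
          field_simp [hs0 x]
      _ = _ := by
          rw [h]
          congr 1
          refine Finset.sum_congr rfl fun x _ => ?_
          simp only [RCLike.inner_apply, conj_trivial]
          rw [← hss x]
          field_simp [hs0 x]
  have hnorm : ∀ f : EuclideanSpace ℝ (Fin n), ∑ x, D x * (f x / s x) ^ 2 = inner ℝ f f := by
    intro f
    rw [PiLp.inner_apply]
    refine Finset.sum_congr rfl fun x _ => ?_
    simp only [RCLike.inner_apply, conj_trivial]
    rw [← hss x]
    field_simp [hs0 x]
  have hcard : 1 < Fintype.card (Fin n) := by simpa using hn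
  let v : EuclideanSpace ℝ (Fin n) := WithLp.toLp 2 s
  obtain ⟨hb1, hb2, hb3⟩ := symmetric_eigenvalues_bounds
    (Matrix.isSymmetric_toEuclideanLin_iff.mpr hA) finrank_euclideanSpace hcard
    (fun f => by
      rw [hquad, sub_nonneg, ← hnorm]; exact energy_le hD hq0 hqd hq1 _)
    (fun f => by rw [hquad]; linarith [energy_nonneg hD hq0 fun x => f x / s x])
    (v := v) (fun h => hs0 ⟨0, by omega⟩ (congrFun (congrArg WithLp.ofLp h) _))
    (by
      ext x
      simp only [Matrix.toLpLin_apply, hApp, v, div_self (hs0 _)]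
      rw [walk_sum]; simp)
    (fun f hf => by
      have h := hquad f
      rw [hf] at h
      obtain ⟨c, hc⟩ := hconn (fun x => f x / s x) (by linarith)
      refine ⟨c, ?_⟩
      ext x
      have := hc x
      rw [div_eq_iff (hs0 x)] at this
      simpa [v] using this)
  have hcard' : n - 1 < Fintype.card (Fin n) := by simp; omega
  have hE1 : eigenvalueDesc (walk q D) 1 = hA.eigenvalues₀ ⟨1, hcard⟩ :=
    eigenvalueDesc_eq hA hchar hcard
  have hEn : eigenvalueDesc (walk q D) (n - 1) = hA.eigenvalues₀ ⟨n - 1, hcard'⟩ :=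
    eigenvalueDesc_eq hA hchar hcard'
  have hle : hA.eigenvalues₀ ⟨n - 1, hcard'⟩ ≤ hA.eigenvalues₀ ⟨1, hcard⟩ :=
    hA.eigenvalues₀_antitone (by rw [Fin.le_def]; change 1 ≤ n - 1; omega)
  have h0 : ∀ i, 0 ≤ hA.eigenvalues₀ i := hb1
  have hgap : absSpectralGap (walk q D) = 1 - hA.eigenvalues₀ ⟨1, hcard⟩ := by
    rw [absSpectralGap, hE1, hEn, abs_of_nonneg (h0 _), max_eq_left hle]
  rw [hgap]
  refine ⟨sub_pos.2 hb2, by linarith [h0 ⟨1, hcard⟩], fun g => ?_⟩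
  set m := ∑ z, D z * g z with hm
  -- Centering `g` and scaling by `√D` gives a vector orthogonal to the top eigenvector `√D`, with
  -- squared norm `wVar D g`.
  let f : EuclideanSpace ℝ (Fin n) := WithLp.toLp 2 fun x => s x * (g x - m)
  have hfs : (fun x => f x / s x) = fun x => g x - m := by
    ext x; simp [f, hs0 x]
  have h3 := hb3 f (by
    rw [PiLp.inner_apply]
    calc _ = ∑ x, D x * (g x - m) := by
          refine Finset.sum_congr rfl fun x _ => ?_
          simp only [RCLike.inner_apply, conj_trivial, f, v, ← hss x]
          ring
      _ = 0 := by simp_rw [mul_sub, Finset.sum_sub_distrib, ← Finset.sum_mul, hD1]; rw [← hm]; ring)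
  have hff : inner ℝ f f = wVar D g := by
    rw [← hnorm, wVar]
    refine Finset.sum_congr rfl fun x _ => ?_
    rw [congrFun hfs x]
  rw [hquad, hfs, energy_sub_const, hff] at h3
  change wVar D g - energy q D g ≤ hA.eigenvalues₀ ⟨1, hcard⟩ * wVar D g at h3
  linarith

end SpectralGap

/-! ### The law of one comparison and its chain -/

instance {Z : Type*} [Fintype Z] : Fintype (Comparison Z) :=
  Fintype.ofEquiv (Z × Finset Z)
    ⟨fun p => ⟨p.1, p.2⟩, fun c => (c.winner, c.set), fun _ => rfl, fun _ => rfl⟩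

namespace LocalSamplingScheme

variable {Z : Type*} (L : LocalSamplingScheme Z)

theorem samp_apply (x : Z) (S : Finset Z) :
    L.samp ⟨x, S⟩ = L.Q S * if h : L.Q S = 0 then 0 else L.condD S h x := by
  classical
  rw [samp, PMF.bindOnSupport_apply, tsum_eq_single S]
  · congr 1
    split_ifs with h
    · rfl
    · rw [PMF.map_apply, tsum_eq_single x]
      · simp
      · intro y hy
        simp [Ne.symm hy]
  · intro S' hS'
    split_ifs with h
    · simp
    · rw [PMF.map_apply, ENNReal.tsum_eq_zero.2, mul_zero]
      intro y
      simp [Ne.symm hS']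

theorem samp_ne_zero {c : Comparison Z} (h : L.samp c ≠ 0) :
    L.Q c.set ≠ 0 ∧ c.winner ∈ c.set := by
  obtain ⟨x, S⟩ := c
  rw [samp_apply] at h
  have hS : L.Q S ≠ 0 := left_ne_zero_of_mul h
  refine ⟨hS, ?_⟩
  have h2 := right_ne_zero_of_mul h
  rw [dif_neg hS] at h2
  exact Finset.mem_coe.1 (by
    by_contra hx
    exact h2 (PMF.filter_apply_eq_zero_of_notMem _ hx))

theorem condD_apply (S : Finset Z) (hS : S ∈ L.Q.support) (x : Z) :
    L.condD S hS x = (S : Set Z).indicator L.D x * (∑' y, (S : Set Z).indicator L.D y)⁻¹ :=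
  PMF.filter_apply _ _

theorem prob_pos (x : Z) : 0 < L.prob x :=
  ENNReal.toReal_pos (L.mem_support_D x) (L.D.apply_ne_top x)

theorem sum_prob [Fintype Z] : ∑ x, L.prob x = 1 := by
  have := L.D.tsum_coe
  rw [tsum_fintype] at this
  rw [← ENNReal.toReal_one, ← this, ENNReal.toReal_sum fun x _ => L.D.apply_ne_top x]
  rfl

theorem one_lt_card {L : LocalSamplingScheme Z} [Fintype Z] (hL : L.IsPairwise) :
    1 < Fintype.card Z := by
  obtain ⟨S, hS⟩ := L.Q.support_nonempty
  have := hL S hS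
  have h2 := Finset.card_le_univ S
  omega

variable [DecidableEq Z]

theorem pairProb_symm (a b : Z) : L.pairProb a b = L.pairProb b a := by
  rw [pairProb, pairProb, Finset.pair_comm]

theorem pairProb_nonneg (a b : Z) : 0 ≤ L.pairProb a b := ENNReal.toReal_nonneg

variable {L}

theorem pairProb_self (hL : L.IsPairwise) (a : Z) : L.pairProb a a = 0 := by
  have : L.Q {a, a} = 0 := by
    by_contra h
    simpa using hL _ h
  rw [pairProb, this, ENNReal.toReal_zero]

theorem move_pair (a b x : Z) : move ⟨a, {a, b}⟩ x = sendTo a b x := by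
  simp only [move, sendTo, Finset.mem_insert, Finset.mem_singleton]
  split_ifs <;> grind

theorem winRate_self (hL : L.IsPairwise) (a : Z) : winRate L.pairProb L.prob a a = 0 := by
  rw [winRate, pairProb_self hL, zero_mul]

theorem winRate_nonneg (L : LocalSamplingScheme Z) (a b : Z) :
    0 ≤ winRate L.pairProb L.prob a b :=
  mul_nonneg (L.pairProb_nonneg _ _) (div_nonneg (L.prob_pos a).le
    (add_pos (L.prob_pos a) (L.prob_pos b)).le)

variable [Fintype Z]

theorem samp_pair {a b : Z} (hab : a ≠ b) :
    (L.samp ⟨a, {a, b}⟩).toReal = winRate L.pairProb L.prob a b := by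
  rw [samp_apply, ENNReal.toReal_mul, winRate, pairProb]
  by_cases h : L.Q {a, b} = 0
  · simp [h]
  rw [dif_neg h, show L.condD {a, b} h a = _ from L.condD_apply _ h a,
    ENNReal.toReal_mul, ENNReal.toReal_inv, tsum_fintype, div_eq_mul_inv]
  have h1 : ∑ x, (({a, b} : Finset Z) : Set Z).indicator L.D x = L.D a + L.D b := by
    rw [← Finset.sum_pair hab, Finset.sum_indicator_subset _ (Finset.subset_univ _)]
  rw [h1, ENNReal.toReal_add (L.D.apply_ne_top a) (L.D.apply_ne_top b),
    Set.indicator_of_mem (by simp)]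
  rfl

/-- Expectations with respect to one comparison, written as sums over winner and loser. -/
theorem sum_samp (hL : L.IsPairwise) (φ : Comparison Z → ℝ) :
    ∑ c, (L.samp c).toReal * φ c =
      ∑ a, ∑ b, winRate L.pairProb L.prob a b * φ ⟨a, {a, b}⟩ := by
  rw [← Fintype.sum_prod_type' (fun a b => winRate L.pairProb L.prob a b * φ ⟨a, {a, b}⟩),
    ← Finset.sum_filter_of_ne (p := fun p : Z × Z => p.1 ≠ p.2)]
  · symm
    refine Finset.sum_of_injOn (fun p : Z × Z => (⟨p.1, {p.1, p.2}⟩ : Comparison Z)) ?_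
      (fun _ _ => by simp) ?_ ?_
    · rintro ⟨a, b⟩ h ⟨a', b'⟩ h' he
      simp only [Finset.coe_filter, Finset.mem_univ, true_and, Set.mem_ofPred_eq] at h h'
      simp only [Comparison.mk.injEq] at he
      obtain ⟨rfl, he⟩ := he
      have : b ∈ ({a, b'} : Finset Z) := he ▸ by simp
      simp only [Finset.mem_insert, Finset.mem_singleton, Ne.symm h, false_or] at this
      rw [this]
    · rintro ⟨x, S⟩ - hc
      by_cases h0 : L.samp ⟨x, S⟩ = 0
      · rw [h0]; simp
      exfalso
      apply hc
      obtain ⟨h1, h2⟩ := L.samp_ne_zero h0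
      obtain ⟨a, b, hab, rfl⟩ := Finset.card_eq_two.1 (hL S h1)
      simp only [Finset.mem_insert, Finset.mem_singleton] at h2
      rcases h2 with rfl | rfl
      · exact ⟨(x, b), by simpa using hab, rfl⟩
      · exact ⟨(x, a), by simpa using hab.symm, by simp [Finset.pair_comm]⟩
    · rintro ⟨a, b⟩ h
      simp only [Finset.mem_filter, Finset.mem_univ, true_and] at h
      rw [samp_pair h]
  · rintro ⟨a, b⟩ - h hab
    simp only at hab
    subst hab
    exact h (by rw [winRate_self hL, zero_mul])

theorem sum_winRate (hL : L.IsPairwise) :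
    ∑ a, ∑ b, winRate L.pairProb L.prob a b = 1 := by
  have := sum_samp hL (fun _ => 1)
  simp only [mul_one] at this
  rw [← this, ← ENNReal.toReal_sum fun c _ => L.samp.apply_ne_top c, ← tsum_fintype
    (L := .unconditional _), L.samp.tsum_coe, ENNReal.toReal_one]

theorem sum_pairProb (hL : L.IsPairwise) : ∑ a, ∑ b, L.pairProb a b = 2 := by
  have h1 := sum_winRate hL
  have h2 : ∑ a, ∑ b, winRate L.pairProb L.prob b a = 1 := by rw [Finset.sum_comm]; exact h1
  calc ∑ a, ∑ b, L.pairProb a b = ∑ a, ∑ b, winRate L.pairProb L.prob a b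
        + ∑ a, ∑ b, winRate L.pairProb L.prob b a := by
        simp_rw [← Finset.sum_add_distrib]
        refine Finset.sum_congr rfl fun a _ => Finset.sum_congr rfl fun b _ => ?_
        have hs := (add_pos (L.prob_pos a) (L.prob_pos b)).ne'
        rw [winRate, winRate, L.pairProb_symm b a, add_comm (L.prob b)]
        field_simp
    _ = 2 := by rw [h1, h2]; norm_num

theorem chain_eq_walk (L : LocalSamplingScheme Z) : L.chain = walk L.pairProb L.prob := by
  ext x y
  have h : ∀ z, L.pairProb x z * (L.prob z / (L.prob x + L.prob z)) =
      winRate L.pairProb L.prob z x := fun z => by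
    rw [winRate, L.pairProb_symm z x, add_comm (L.prob z)]
  simp only [chain, walk, h]

theorem sum_winRate_sendTo (hL : L.IsPairwise) (g : Z → ℝ) (x : Z) :
    ∑ a, ∑ b, winRate L.pairProb L.prob a b * g (sendTo a b x) = ∑ y, L.chain x y * g y := by
  have h : ∀ a b, winRate L.pairProb L.prob a b * g (sendTo a b x) =
      winRate L.pairProb L.prob a b * g x +
        if b = x then winRate L.pairProb L.prob a b * (g a - g x) else 0 := by
    intro a b
    rw [sendTo]
    split_ifs with h1 h2 h2
    · ring
    · exact absurd h1.symm h2
    · exact absurd h2.symm h1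
    · ring
  simp only [h, Finset.sum_add_distrib, ← Finset.sum_mul, sum_winRate hL, one_mul,
    Finset.sum_ite_eq', Finset.mem_univ, if_true]
  rw [chain_eq_walk, walk_sum]

theorem chain_eq_sum (hL : L.IsPairwise) (x y : Z) :
    L.chain x y = ∑ a, ∑ b, winRate L.pairProb L.prob a b *
      (if sendTo a b x = y then 1 else 0) := by
  rw [sum_winRate_sendTo hL (fun z => if z = y then 1 else 0)]
  simp

theorem chain_nonneg (hL : L.IsPairwise) (x y : Z) : 0 ≤ L.chain x y := by
  rw [chain_eq_sum hL]
  exact Finset.sum_nonneg fun a _ => Finset.sum_nonneg fun b _ =>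
    mul_nonneg (winRate_nonneg L a b) (by split_ifs <;> norm_num)

theorem sum_chain (L : LocalSamplingScheme Z) (x : Z) : ∑ y, L.chain x y = 1 := by
  simpa [chain_eq_walk] using walk_sum (q := L.pairProb) (D := L.prob) (fun _ => 1) x

theorem chain_mem_rowStochastic (hL : L.IsPairwise) : L.chain ∈ Matrix.rowStochastic ℝ Z := by
  refine ⟨chain_nonneg hL, ?_⟩
  ext x
  simpa [Matrix.mulVec, dotProduct] using sum_chain L x

theorem chain_reversible (L : LocalSamplingScheme Z) (x y : Z) :
    L.prob x * L.chain x y = L.prob y * L.chain y x := by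
  rw [chain_eq_walk]
  exact walk_reversible L.pairProb_symm x y

theorem sum_prob_mul_chain (L : LocalSamplingScheme Z) (y : Z) :
    ∑ x, L.prob x * L.chain x y = L.prob y := by
  simp_rw [chain_reversible L _ y, ← Finset.mul_sum, sum_chain, mul_one]

/-- Every edge has positive conductance, so zero energy forces equality along edges, and
connectedness does the rest. -/
theorem eq_const_of_energy_eq_zero (hc : L.graph.Connected) {g : Z → ℝ}
    (hg : energy L.pairProb L.prob g = 0) : ∃ c : ℝ, ∀ x, g x = c := by
  have hterm : ∀ a b, 0 ≤ L.pairProb a b *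
      (L.prob a * L.prob b / (L.prob a + L.prob b) * (g a - g b) ^ 2) := fun a b =>
    mul_nonneg (L.pairProb_nonneg a b) (mul_nonneg (div_nonneg
      (mul_pos (L.prob_pos a) (L.prob_pos b)).le
      (add_pos (L.prob_pos a) (L.prob_pos b)).le) (sq_nonneg _))
  have hadj : ∀ a b, L.graph.Adj a b → g a = g b := by
    intro a b hab
    have h0 : ∑ a, ∑ b, L.pairProb a b *
      (L.prob a * L.prob b / (L.prob a + L.prob b) * (g a - g b) ^ 2) = 0 := by
      rw [energy] at hg; linarith
    have h1 := (Finset.sum_eq_zero_iff_of_nonneg fun a _ =>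
      Finset.sum_nonneg fun b _ => hterm a b).1 h0 a (Finset.mem_univ a)
    have h2 := (Finset.sum_eq_zero_iff_of_nonneg fun b _ => hterm a b).1 h1 b (Finset.mem_univ b)
    have hq : L.pairProb a b ≠ 0 := (ENNReal.toReal_pos hab.2 (L.Q.apply_ne_top _)).ne'
    have hd : L.prob a * L.prob b / (L.prob a + L.prob b) ≠ 0 :=
      (div_pos (mul_pos (L.prob_pos a) (L.prob_pos b))
        (add_pos (L.prob_pos a) (L.prob_pos b))).ne'
    have h3 := (mul_eq_zero.1 ((mul_eq_zero.1 h2).resolve_left hq)).resolve_left hd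
    exact sub_eq_zero.1 (pow_eq_zero_iff two_ne_zero |>.1 h3)
  obtain ⟨x₀⟩ := hc.nonempty
  refine ⟨g x₀, fun x => ?_⟩
  obtain ⟨w⟩ := hc.preconnected x x₀
  induction w with
  | nil => rfl
  | cons h _ ih => rw [hadj _ _ h, ih]

theorem vecMul_chain_eq_iff (hc : L.graph.Connected) {π : Z → ℝ} (hπ : π ∈ stdSimplex ℝ Z) :
    Matrix.vecMul π L.chain = π ↔ π = L.prob := by
  constructor
  · intro h
    -- Reversibility turns the stationary `π` into a harmonic density `π / D`, whose Dirichlet form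
    -- therefore vanishes.
    have h' : ∀ y, ∑ x, L.chain y x * (π x / L.prob x) = π y / L.prob y := by
      intro y
      have hy : ∑ x, π x * L.chain x y = π y := congrFun h y
      rw [eq_div_iff (L.prob_pos y).ne', ← hy, Finset.sum_mul]
      refine Finset.sum_congr rfl fun x _ => ?_
      have := chain_reversible L x y
      have hx := (L.prob_pos x).ne'
      field_simp
      linear_combination -π x * this
    have he : energy L.pairProb L.prob (fun x => π x / L.prob x) = 0 := by
      have := sum_mul_walk (D := L.prob) L.pairProb_symm (fun x => π x / L.prob x)
      rw [← chain_eq_walk] at this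
      simp_rw [h'] at this
      have e : ∀ x, L.prob x * (π x / L.prob x) * (π x / L.prob x) =
          L.prob x * (π x / L.prob x) ^ 2 := fun x => by ring
      simp_rw [e] at this
      linarith
    obtain ⟨c, hcc⟩ := eq_const_of_energy_eq_zero hc he
    have hx : ∀ x, π x = c * L.prob x := fun x => by
      rw [← hcc x, div_mul_cancel₀ _ (L.prob_pos x).ne']
    have h1 : c = 1 := by
      have := hπ.2
      simp_rw [hx, ← Finset.mul_sum, L.sum_prob, mul_one] at this
      exact this
    ext x
    rw [hx, h1, one_mul]
  · rintro rfl
    ext y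
    exact sum_prob_mul_chain L y

theorem absSpectralGap_chain {n : ℕ} {L : LocalSamplingScheme (Fin n)} (hL : L.IsPairwise)
    (hc : L.graph.Connected) :
    0 < absSpectralGap L.chain ∧ absSpectralGap L.chain ≤ 1 ∧
      ∀ g, absSpectralGap L.chain * wVar L.prob g ≤ energy L.pairProb L.prob g := by
  rw [chain_eq_walk]
  exact absSpectralGap_walk (by simpa using one_lt_card hL) L.prob_pos L.sum_prob L.pairProb_symm
    L.pairProb_nonneg (pairProb_self hL) (sum_pairProb hL)
    fun g hg => eq_const_of_energy_eq_zero hc hg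

end LocalSamplingScheme

/-! ### Coalescence and the number of samples -/

section Coalescence

variable {Z : Type*} [DecidableEq Z]

theorem flow_congr {c c' : ℕ → Comparison Z} {t : ℕ} (h : ∀ s < t, c s = c' s) :
    flow c t = flow c' t := by
  induction t with
  | zero => rfl
  | succ t ih =>
    ext x
    rw [flow, flow, h t (Nat.lt_succ_self t), ih fun s hs => h s (hs.trans (Nat.lt_succ_self t))]

/-- New samples are composed on the inside (in the past), so a constant map stays the same constant.
-/
theorem Coalesced.flow_eq {c : ℕ → Comparison Z} {s t : ℕ} (hs : Coalesced c s) (hst : s ≤ t)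
    (x y : Z) : flow c t x = flow c s y := by
  induction t, hst using Nat.le_induction generalizing x with
  | base => exact hs x y
  | succ t _ ih => exact ih (move (c t) x)

theorem exists_coalesced_of_numSamples_ne_top {c : ℕ → Comparison Z} (h : numSamples c ≠ ⊤) :
    ∃ t, Coalesced c t := by
  by_contra! hc
  exact h (by simp [numSamples, hc])

theorem numSamples_le {c : ℕ → Comparison Z} {t : ℕ} (h : Coalesced c t) :
    numSamples c ≤ t := iInf₂_le t h

/-- If the flow coalesces, the number of samples is attained as a least time of coalescence. -/
theorem exists_numSamples_eq {c : ℕ → Comparison Z} (h : ∃ t, Coalesced c t) :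
    ∃ N : ℕ, numSamples c = N ∧ Coalesced c N ∧ ∀ t < N, ¬ Coalesced c t := by
  classical
  refine ⟨Nat.find h, le_antisymm (numSamples_le (Nat.find_spec h)) ?_, Nat.find_spec h,
    fun t => Nat.find_min h⟩
  exact le_iInf₂ fun t ht => Nat.cast_le.2 (Nat.find_min' h ht)

theorem flow_eq_output {n : ℕ} [NeZero n] {c : ℕ → Comparison (Fin n)} {t : ℕ}
    (h : Coalesced c t) (y : Fin n) : flow c t y = output c := by
  obtain ⟨N, hN, hc, -⟩ := exists_numSamples_eq ⟨t, h⟩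
  have hNt : N ≤ t := by
    have := numSamples_le h
    rw [hN] at this
    exact_mod_cast this
  rw [output, hN, ENat.toNat_natCast, hc.flow_eq hNt y 0]

end Coalescence

/-! ### Independent samples -/

section Samples

open LocalSamplingScheme

theorem measureReal_eq_sum {Z : Type*} [Fintype Z] {Ω : Type*} [MeasurableSpace Ω]
    {μ : Measure Ω} [IsProbabilityMeasure μ] (X : Ω → Comparison Z) (hX : Measurable X) (A : Set Ω) :
    μ.real A = ∑ c, μ.real (X ⁻¹' {c} ∩ A) := by
  have h := sum_measure_preimage_singleton (μ := μ.restrict A) (f := X) Finset.univ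
    fun c _ => hX trivial
  simp only [Finset.coe_univ, Set.preimage_univ, Measure.restrict_apply_univ] at h
  rw [Measure.real, ← h, ENNReal.toReal_sum fun c _ => measure_ne_top _ _]
  refine Finset.sum_congr rfl fun c _ => ?_
  rw [Measure.restrict_apply (hX trivial), Measure.real]

theorem measureReal_sample_eq {Z : Type*} {L : LocalSamplingScheme Z} {Ω : Type*}
    [MeasurableSpace Ω] {μ : Measure Ω} {ξ : ℕ → Ω → Comparison Z}
    (hlaw : ∀ t, HasLaw (ξ t) L.samp.toMeasure μ) (t : ℕ)
    (c : Comparison Z) : μ.real (ξ t ⁻¹' {c}) = (L.samp c).toReal := by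
  rw [Measure.real, ← Measure.map_apply_of_aemeasurable (hlaw t).aemeasurable trivial,
    (hlaw t).map_eq, PMF.toMeasure_apply_singleton _ _ (show MeasurableSet {c} from trivial)]

/-- There are finitely many comparisons, so those of probability zero can be discarded
simultaneously; the program analysis needs this along the whole sample path. -/
theorem ae_sample_mem {Z : Type*} [Fintype Z] {L : LocalSamplingScheme Z} {Ω : Type*}
    [MeasurableSpace Ω] {μ : Measure Ω} [IsProbabilityMeasure μ] {ξ : ℕ → Ω → Comparison Z}
    (hL : L.IsPairwise)
    (hlaw : ∀ t, HasLaw (ξ t) L.samp.toMeasure μ) :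
    ∀ᵐ ω ∂μ, ∀ t, (ξ t ω).set.card = 2 ∧ (ξ t ω).winner ∈ (ξ t ω).set := by
  rw [ae_all_iff]
  intro t
  have h : ∀ᵐ ω ∂μ, ∀ c, L.samp c = 0 → ξ t ω ≠ c := by
    rw [ae_all_iff]
    intro c
    by_cases hc : L.samp c = 0
    · have := measureReal_sample_eq hlaw t c
      rw [hc, ENNReal.toReal_zero, measureReal_eq_zero_iff] at this
      filter_upwards [measure_eq_zero_iff_ae_notMem.1 this] with ω hω _ using hω
    · exact ae_of_all _ fun ω h0 => absurd h0 hc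
  filter_upwards [h] with ω hω
  have h1 := L.samp_ne_zero (c := ξ t ω) fun h0 => hω _ h0 rfl
  exact ⟨hL _ h1.1, h1.2⟩

variable {Z : Type*} [DecidableEq Z] [Fintype Z] {L : LocalSamplingScheme Z}
  {Ω : Type*} [MeasurableSpace Ω] {μ : Measure Ω} [IsProbabilityMeasure μ]
  {ξ : ℕ → Ω → Comparison Z}

theorem measureReal_sample (hL : L.IsPairwise) (hm : ∀ t, Measurable (ξ t))
    (hlaw : ∀ t, HasLaw (ξ t) L.samp.toMeasure μ) (t : ℕ) (R : Comparison Z → Prop)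
    [DecidablePred R] :
    μ.real {ω | R (ξ t ω)} =
      ∑ a, ∑ b, winRate L.pairProb L.prob a b * if R ⟨a, {a, b}⟩ then 1 else 0 := by
  rw [measureReal_eq_sum (ξ t) (hm t), ← sum_samp hL fun c => if R c then 1 else 0]
  refine Finset.sum_congr rfl fun c _ => ?_
  rw [← measureReal_sample_eq hlaw t c]
  split_ifs with h
  · rw [mul_one, Set.inter_eq_left.2]
    rintro ω rfl
    exact h
  · rw [mul_zero, ← measureReal_empty (μ := μ)]
    congr 1
    ext ω
    simp only [Set.mem_inter_iff, Set.mem_preimage, Set.mem_singleton_iff, Set.mem_ofPred_eq,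
      Set.mem_empty_iff_false, iff_false, not_and]
    rintro rfl
    exact h

theorem measure_move_eq (hL : L.IsPairwise) (hm : ∀ t, Measurable (ξ t))
    (hlaw : ∀ t, HasLaw (ξ t) L.samp.toMeasure μ) (t : ℕ) (x y : Z) :
    μ {ω | move (ξ t ω) x = y} = ENNReal.ofReal (L.chain x y) := by
  have h := measureReal_sample hL hm hlaw t (fun c => move c x = y)
  simp_rw [move_pair] at h
  rw [chain_eq_sum hL, ← h, ofReal_measureReal]

/-- Condition on the sample `ξ t`: the flow up to time `t` depends only on the earlier samples and
is independent of it. -/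
theorem measureReal_flow_succ [Nonempty Z] (hL : L.IsPairwise) (hm : ∀ t, Measurable (ξ t))
    (hind : iIndepFun ξ μ) (hlaw : ∀ t, HasLaw (ξ t) L.samp.toMeasure μ) (t : ℕ)
    (R : (Z → Z) → Prop) :
    μ.real {ω | R (flow (fun s => ξ s ω) (t + 1))} =
      ∑ a, ∑ b, winRate L.pairProb L.prob a b *
        μ.real {ω | R (fun x => flow (fun s => ξ s ω) t (sendTo a b x))} := by
  have hc := sum_samp hL fun c => μ.real {ω | R (fun x => flow (fun s => ξ s ω) t (move c x))}
  simp_rw [move_pair] at hc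
  rw [← hc, measureReal_eq_sum (ξ t) (hm t)]
  refine Finset.sum_congr rfl fun c _ => ?_
  -- A dummy value extends the finitely many relevant samples to a sequence; `flow_congr` shows that
  -- it is never read.
  let c₀ : Comparison Z := ⟨Classical.arbitrary Z, ∅⟩
  let P : Set (Finset.range t → Comparison Z) :=
    {p | R fun x => flow (fun s => if h : s ∈ Finset.range t then p ⟨s, h⟩ else c₀) t (move c x)}
  let W : Set (({t} : Finset ℕ) → Comparison Z) := {p | p ⟨t, Finset.mem_singleton_self t⟩ = c}
  have hi := (hind.indepFun_finset (Finset.range t) {t} (by simp) hm).measure_inter_preimage_eq_mul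
    P W (Set.toFinite P).measurableSet (Set.toFinite W).measurableSet
  have hP : (fun a (i : Finset.range t) => ξ i a) ⁻¹' P =
      {ω | R (fun x => flow (fun s => ξ s ω) t (move c x))} := by
    ext ω
    have : flow (fun s => if _ : s ∈ Finset.range t then ξ s ω else c₀) t =
        flow (fun s => ξ s ω) t := flow_congr fun s hs => by simp [hs]
    simp only [P, Set.mem_preimage, Set.mem_ofPred_eq, this]
  have hW : (fun a (i : ({t} : Finset ℕ)) => ξ i a) ⁻¹' W = ξ t ⁻¹' {c} := rfl
  rw [hP, hW] at hi
  have e : ξ t ⁻¹' {c} ∩ {ω | R (flow (fun s => ξ s ω) (t + 1))} =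
      {ω | R (fun x => flow (fun s => ξ s ω) t (move c x))} ∩ ξ t ⁻¹' {c} := by
    ext ω
    simp only [Set.mem_inter_iff, Set.mem_preimage, Set.mem_singleton_iff, Set.mem_ofPred_eq]
    rw [and_comm]
    refine and_congr_left ?_
    rintro rfl
    exact Iff.rfl
  rw [e, Measure.real, hi, ENNReal.toReal_mul, ← measureReal_sample_eq hlaw t c, mul_comm]
  rfl

theorem measureReal_flow_ne [Nonempty Z] (hL : L.IsPairwise) (hm : ∀ t, Measurable (ξ t))
    (hind : iIndepFun ξ μ) (hlaw : ∀ t, HasLaw (ξ t) L.samp.toMeasure μ) (t : ℕ) (x y : Z) :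
    μ.real {ω | flow (fun s => ξ s ω) t x ≠ flow (fun s => ξ s ω) t y} =
      (pairStep L.pairProb L.prob)^[t] (fun x y => if x = y then 0 else 1) x y := by
  induction t generalizing x y with
  | zero =>
    by_cases h : x = y
    · simp [flow, h]
    · simp [flow, h]
  | succ t ih =>
    rw [measureReal_flow_succ hL hm hind hlaw t (fun F => F x ≠ F y), Function.iterate_succ_apply',
      pairStep]
    simp_rw [ih]

/-- A walk started from the stationary distribution keeps it; this is invariance of `D` under the
chain, iterated. -/
theorem sum_prob_mul_measureReal_flow [Nonempty Z] (hL : L.IsPairwise)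
    (hm : ∀ t, Measurable (ξ t)) (hind : iIndepFun ξ μ)
    (hlaw : ∀ t, HasLaw (ξ t) L.samp.toMeasure μ) (t : ℕ) (x : Z) :
    ∑ y, L.prob y * μ.real {ω | flow (fun s => ξ s ω) t y = x} = L.prob x := by
  induction t with
  | zero =>
    have : ∀ y, μ.real {_ω : Ω | y = x} = if y = x then 1 else 0 := by
      intro y
      by_cases h : y = x <;> simp [h]
    simp [flow, this]
  | succ t ih =>
    have h : ∀ y, μ.real {ω | flow (fun s => ξ s ω) (t + 1) y = x} =
        ∑ z, L.chain y z * μ.real {ω | flow (fun s => ξ s ω) t z = x} := by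
      intro y
      rw [measureReal_flow_succ hL hm hind hlaw t (fun F => F y = x),
        sum_winRate_sendTo hL fun z => μ.real {ω | flow (fun s => ξ s ω) t z = x}]
    simp_rw [h, Finset.mul_sum, ← mul_assoc]
    rw [Finset.sum_comm]
    simp_rw [← Finset.sum_mul, sum_prob_mul_chain]
    exact ih

end Samples

/-! ### The tail of the number of samples and the law of the output -/

section Tail

open LocalSamplingScheme Filter Topology

theorem minProb_le {n : ℕ} (L : LocalSamplingScheme (Fin n)) (x : Fin n) : L.minProb ≤ L.prob x :=
  ciInf_le (Set.finite_range _).bddBelow x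

theorem card_mul_minProb_le {n : ℕ} (L : LocalSamplingScheme (Fin n)) : n * L.minProb ≤ 1 := by
  rw [← L.sum_prob]
  simpa using Finset.card_nsmul_le_sum Finset.univ L.prob _ fun x _ => minProb_le L x

variable {n : ℕ} [NeZero n] {L : LocalSamplingScheme (Fin n)}

theorem minProb_pos (L : LocalSamplingScheme (Fin n)) : 0 < L.minProb := by
  obtain ⟨x, hx⟩ := exists_eq_ciInf_of_finite (f := L.prob)
  rw [minProb, ← hx]
  exact L.prob_pos x

theorem exp_log_one_div_minProb (L : LocalSamplingScheme (Fin n)) :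
    Real.exp (Real.log (1 / L.minProb)) = 1 / L.minProb :=
  Real.exp_log (one_div_pos.2 (minProb_pos L))

variable {Ω : Type*} [MeasurableSpace Ω] {μ : Measure Ω} [IsProbabilityMeasure μ]
  {ξ : ℕ → Ω → Comparison (Fin n)}

/-- A single term of the weighted second moment has weight at least `minProb ^ 2`. Taking the square
root halves the decay rate, which gives the `2 * n`, and leaves one factor `1 / minProb`. -/
theorem measureReal_flow_ne_le (hL : L.IsPairwise) (hc : L.graph.Connected)
    (hm : ∀ t, Measurable (ξ t)) (hind : iIndepFun ξ μ)
    (hlaw : ∀ t, HasLaw (ξ t) L.samp.toMeasure μ) (t : ℕ) (x y : Fin n) :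
    μ.real {ω | flow (fun s => ξ s ω) t x ≠ flow (fun s => ξ s ω) t y} ≤
      Real.exp (Real.log (1 / L.minProb) - absSpectralGap L.chain * t / (2 * n)) := by
  obtain ⟨hg0, hg1, hgap⟩ := absSpectralGap_chain hL hc
  set γ := absSpectralGap L.chain
  have hn : (1 : ℝ) ≤ n := by exact_mod_cast NeZero.one_le
  have hdec := iterate_pairStep_sq_le L.prob_pos L.sum_prob L.pairProb_symm L.pairProb_nonneg
    (pairProb_self hL) (sum_pairProb hL) hg0.le hg1 hgap
    (u := fun x y => if x = y then 0 else 1) (fun x => if_pos rfl) t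
  rw [Fintype.card_fin] at hdec
  rw [measureReal_flow_ne hL hm hind hlaw]
  set S := (pairStep L.pairProb L.prob)^[t] (fun x y => if x = y then 0 else 1)
  have hu : ∑ x, ∑ y, L.prob x * L.prob y * (if x = y then (0 : ℝ) else 1) ^ 2 ≤ 1 := by
    calc _ ≤ ∑ x, ∑ y, L.prob x * L.prob y :=
          Finset.sum_le_sum fun x _ => Finset.sum_le_sum fun y _ =>
            mul_le_of_le_one_right (mul_pos (L.prob_pos x) (L.prob_pos y)).le
              (by split_ifs <;> norm_num)
      _ = 1 := by simp_rw [← Finset.mul_sum, L.sum_prob, mul_one, L.sum_prob]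
  have hρ0 : 0 ≤ 1 - γ / n := by
    rw [sub_nonneg, div_le_one (by linarith)]
    linarith
  have hρ : (1 - γ / n) ^ t ≤ Real.exp (-(γ * t / n)) := by
    calc (1 - γ / n) ^ t ≤ Real.exp (-(γ / n)) ^ t :=
          pow_le_pow_left₀ hρ0 (Real.one_sub_le_exp_neg _) t
      _ = _ := by rw [← Real.exp_nat_mul]; congr 1; ring
  have hterm : L.prob x * L.prob y * S x y ^ 2 ≤ Real.exp (-(γ * t / n)) := by
    have hnn : ∀ x y, 0 ≤ L.prob x * L.prob y * S x y ^ 2 := fun x y =>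
      mul_nonneg (mul_pos (L.prob_pos x) (L.prob_pos y)).le (sq_nonneg _)
    calc _ ≤ ∑ y, L.prob x * L.prob y * S x y ^ 2 :=
          Finset.single_le_sum (fun y _ => hnn x y) (Finset.mem_univ y)
      _ ≤ ∑ x, ∑ y, L.prob x * L.prob y * S x y ^ 2 :=
          Finset.single_le_sum (f := fun x => ∑ y, L.prob x * L.prob y * S x y ^ 2)
            (fun x _ => Finset.sum_nonneg fun y _ => hnn x y) (Finset.mem_univ x)
      _ ≤ (1 - γ / n) ^ t * 1 :=
          hdec.trans (mul_le_mul_of_nonneg_left hu (pow_nonneg hρ0 t))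
      _ ≤ _ := by rw [mul_one]; exact hρ
  have hm0 := minProb_pos L
  have hmm : L.minProb ^ 2 * S x y ^ 2 ≤ Real.exp (-(γ * t / n)) := by
    refine le_trans (mul_le_mul_of_nonneg_right ?_ (sq_nonneg _)) hterm
    rw [sq]
    exact mul_le_mul (minProb_le L x) (minProb_le L y) hm0.le (L.prob_pos x).le
  rw [Real.exp_sub, exp_log_one_div_minProb, div_div, le_div_iff₀ (by positivity)]
  refine le_of_sq_le_sq ?_ zero_le_one
  have he : Real.exp (γ * t / (2 * n)) ^ 2 = Real.exp (γ * t / n) := by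
    rw [← Real.exp_nat_mul]; congr 1; push_cast; field_simp
  have := mul_le_mul_of_nonneg_right hmm (Real.exp_pos (γ * t / n)).le
  rw [← Real.exp_add, neg_add_cancel, Real.exp_zero] at this
  rw [mul_pow, mul_pow, he]
  linarith

/-- A union bound over `n ^ 2` pairs, with `n ≤ 1 / minProb`, raises the coefficient of the
logarithm from one to three. -/
theorem measureReal_not_coalesced_le (hL : L.IsPairwise) (hc : L.graph.Connected)
    (hm : ∀ t, Measurable (ξ t)) (hind : iIndepFun ξ μ)
    (hlaw : ∀ t, HasLaw (ξ t) L.samp.toMeasure μ) (t : ℕ) :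
    μ.real {ω | ¬ Coalesced (fun s => ξ s ω) t} ≤
      Real.exp (3 * Real.log (1 / L.minProb) - absSpectralGap L.chain * t / (2 * n)) := by
  have hset : {ω | ¬ Coalesced (fun s => ξ s ω) t} =
      ⋃ x, ⋃ y, {ω | flow (fun s => ξ s ω) t x ≠ flow (fun s => ξ s ω) t y} := by
    ext ω
    simp [Coalesced]
  have hnm := card_mul_minProb_le L
  have hm0 := minProb_pos L
  have hnL : (n : ℝ) ≤ Real.exp (Real.log (1 / L.minProb)) := by
    rw [exp_log_one_div_minProb, le_div_iff₀ hm0]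
    exact hnm
  set E := Real.exp (Real.log (1 / L.minProb) - absSpectralGap L.chain * t / (2 * n)) with hE
  calc _ ≤ ∑ x : Fin n, ∑ y : Fin n, E := by
        rw [hset]
        refine (measureReal_iUnion_fintype_le _).trans (Finset.sum_le_sum fun x _ => ?_)
        exact (measureReal_iUnion_fintype_le _).trans (Finset.sum_le_sum fun y _ =>
          measureReal_flow_ne_le hL hc hm hind hlaw t x y)
    _ = n * n * E := by simp [mul_assoc]
    _ ≤ Real.exp (Real.log (1 / L.minProb)) * Real.exp (Real.log (1 / L.minProb)) * E := by
        gcongr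
    _ = _ := by
        rw [hE, ← Real.exp_add, ← Real.exp_add]
        congr 1
        ring

theorem tendsto_tail_bound {g : ℝ} (hg : 0 < g) (K : ℝ) :
    Tendsto (fun t : ℕ => Real.exp (K - g * t / (2 * n))) atTop (𝓝 0) := by
  have hn : (0 : ℝ) < n := by exact_mod_cast NeZero.pos n
  refine Real.tendsto_exp_atBot.comp ?_
  have h1 : Tendsto (fun t : ℕ => g / (2 * n) * (t : ℝ)) atTop atTop :=
    tendsto_natCast_atTop_atTop.const_mul_atTop (by positivity)
  have h2 := tendsto_atBot_add_const_left atTop K (tendsto_neg_atTop_atBot.comp h1)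
  refine h2.congr fun t => ?_
  simp only [Function.comp]
  ring

theorem ae_numSamples_ne_top (hL : L.IsPairwise) (hc : L.graph.Connected)
    (hm : ∀ t, Measurable (ξ t)) (hind : iIndepFun ξ μ)
    (hlaw : ∀ t, HasLaw (ξ t) L.samp.toMeasure μ) :
    ∀ᵐ ω ∂μ, numSamples (fun t => ξ t ω) ≠ ⊤ := by
  rw [ae_iff, ← measureReal_eq_zero_iff]
  refine le_antisymm (ge_of_tendsto' (tendsto_tail_bound (n := n) (absSpectralGap_chain hL hc).1
    (3 * Real.log (1 / L.minProb))) fun t => ?_) measureReal_nonneg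
  refine (measureReal_mono ?_).trans (measureReal_not_coalesced_le hL hc hm hind hlaw t)
  intro ω hω hcoal
  exact hω (ne_top_of_le_ne_top (ENat.natCast_ne_top t) (numSamples_le hcoal))

theorem measure_output_eq (hL : L.IsPairwise) (hc : L.graph.Connected)
    (hm : ∀ t, Measurable (ξ t)) (hind : iIndepFun ξ μ)
    (hlaw : ∀ t, HasLaw (ξ t) L.samp.toMeasure μ) (x : Fin n) :
    μ {ω | numSamples (fun t => ξ t ω) ≠ ⊤ ∧ output (fun t => ξ t ω) = x} = L.D x := by
  set O := {ω | numSamples (fun t => ξ t ω) ≠ ⊤ ∧ output (fun t => ξ t ω) = x} with hO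
  set B : ℕ → Set Ω := fun t => {ω | ¬ Coalesced (fun s => ξ s ω) t} with hB
  set F : ℕ → Fin n → Set Ω := fun t y => {ω | flow (fun s => ξ s ω) t y = x} with hF
  have h1 : ∀ t y, μ.real O ≤ μ.real (F t y) + μ.real (B t) := fun t y => by
    refine (measureReal_mono ?_).trans (measureReal_union_le _ _)
    intro ω hω
    by_cases h : Coalesced (fun s => ξ s ω) t
    · exact Or.inl ((flow_eq_output h y).trans hω.2)
    · exact Or.inr h
  have h2 : ∀ t y, μ.real (F t y) ≤ μ.real O + μ.real (B t) := fun t y => by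
    refine (measureReal_mono ?_).trans (measureReal_union_le _ _)
    intro ω hω
    by_cases h : Coalesced (fun s => ξ s ω) t
    · exact Or.inl ⟨ne_top_of_le_ne_top (ENat.natCast_ne_top t) (numSamples_le h),
        (flow_eq_output h y).symm.trans hω⟩
    · exact Or.inr h
  -- `h1` and `h2` hold for every start `y`, so averaging over `D` replaces the flow probability by
  -- `L.prob x`.
  have h3 : ∀ t, |μ.real O - L.prob x| ≤ μ.real (B t) := fun t => by
    have hs := sum_prob_mul_measureReal_flow hL hm hind hlaw t x
    have e : μ.real O - L.prob x = ∑ y, L.prob y * (μ.real O - μ.real (F t y)) := by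
      simp_rw [mul_sub, Finset.sum_sub_distrib, ← Finset.sum_mul, L.sum_prob, one_mul]
      rw [hs]
    rw [e]
    calc _ ≤ ∑ y, |L.prob y * (μ.real O - μ.real (F t y))| := Finset.abs_sum_le_sum_abs _ _
      _ ≤ ∑ y, L.prob y * μ.real (B t) := by
          refine Finset.sum_le_sum fun y _ => ?_
          rw [abs_mul, abs_of_pos (L.prob_pos y)]
          refine mul_le_mul_of_nonneg_left (abs_le.2 ⟨?_, ?_⟩) (L.prob_pos y).le
          · linarith [h2 t y]
          · linarith [h1 t y]
      _ = _ := by rw [← Finset.sum_mul, L.sum_prob, one_mul]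
  have h4 : |μ.real O - L.prob x| ≤ 0 :=
    ge_of_tendsto' (tendsto_tail_bound (n := n) (absSpectralGap_chain hL hc).1 _) fun t =>
      (h3 t).trans (measureReal_not_coalesced_le hL hc hm hind hlaw t)
  have h5 : μ.real O = L.prob x := sub_eq_zero.1 (abs_eq_zero.1 (le_antisymm h4 (abs_nonneg _)))
  rw [← ofReal_measureReal (μ := μ) (s := O), h5, prob, ENNReal.ofReal_toReal (L.D.apply_ne_top x)]

theorem measure_numSamples_le (hL : L.IsPairwise) (hc : L.graph.Connected)
    (hm : ∀ t, Measurable (ξ t)) (hind : iIndepFun ξ μ)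
    (hlaw : ∀ t, HasLaw (ξ t) L.samp.toMeasure μ) {δ : ℝ} (hδ : 0 < δ) :
    ENNReal.ofReal (1 - δ) ≤ μ {ω | ∃ N : ℕ, numSamples (fun t => ξ t ω) = N ∧
      (N : ℝ) ≤ 12 * (n * Real.log (1 / L.minProb) / absSpectralGap L.chain) *
        max 1 (Real.log (1 / δ))} := by
  obtain ⟨hg0, hg1, -⟩ := absSpectralGap_chain hL hc
  set γ := absSpectralGap L.chain
  set m := max 1 (Real.log (1 / δ)) with hmdef
  set K := Real.log (1 / L.minProb) with hK
  have hn2 : (2 : ℝ) ≤ n := by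
    have := one_lt_card hL
    rw [Fintype.card_fin] at this
    exact_mod_cast this
  have hm0 := minProb_pos L
  -- Pairwise comparison forces `n ≥ 2`, so `minProb ≤ 1 / 2` and `K ≥ log 2`.
  have hK2 : 1 / 2 ≤ K := by
    have h1 : (2 : ℝ) ≤ 1 / L.minProb := by
      rw [le_div_iff₀ hm0]
      nlinarith [card_mul_minProb_le L]
    have h2 := Real.log_le_log two_pos h1
    linarith [Real.log_two_gt_d9]
  have hm1 : 1 ≤ m := le_max_left _ _
  have hmδ : Real.log (1 / δ) ≤ m := le_max_right _ _
  set b := 12 * (n * K / γ) * m with hb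
  set T := ⌊b⌋₊ with hT
  have hb0 : 0 ≤ b := by positivity
  have hnKm : 1 ≤ n * K * m := by nlinarith [mul_le_mul hn2 hK2 (by norm_num) (by linarith)]
  have hbγ : b * γ = 12 * (n * K * m) := by
    rw [hb]; field_simp
  have hTb : b - 1 ≤ T := by linarith [Nat.lt_floor_add_one b]
  -- The floor costs at most `1 ≤ n * K * m`, so `12` leaves at least `10`; dividing by `2 * n`
  -- gives `5 * K * m`. Subtracting `3 * K ≤ 3 * K * m` leaves `2 * K * m ≥ m ≥ log (1 / δ)`.
  have hexp : 3 * K - γ * T / (2 * n) ≤ Real.log δ := by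
    have h1 : 10 * (n * K * m) ≤ γ * T := by nlinarith
    have h2 : 5 * (K * m) ≤ γ * T / (2 * n) := by
      rw [le_div_iff₀ (by linarith)]; nlinarith
    rw [one_div, Real.log_inv] at hmδ
    nlinarith
  have htail := (measureReal_not_coalesced_le hL hc hm hind hlaw T).trans
    (Real.exp_le_exp.2 hexp)
  rw [Real.exp_log hδ] at htail
  -- Subadditivity in place of complementation avoids proving the event measurable.
  have hone : 1 ≤ μ.real {ω | Coalesced (fun s => ξ s ω) T} +
      μ.real {ω | ¬ Coalesced (fun s => ξ s ω) T} := by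
    rw [← probReal_univ (μ := μ)]
    refine (measureReal_mono ?_).trans (measureReal_union_le _ _)
    intro ω _
    exact em _
  calc ENNReal.ofReal (1 - δ) ≤ ENNReal.ofReal (μ.real {ω | Coalesced (fun s => ξ s ω) T}) :=
        ENNReal.ofReal_le_ofReal (by linarith)
    _ = μ {ω | Coalesced (fun s => ξ s ω) T} := ofReal_measureReal
    _ ≤ _ := by
        refine measure_mono fun ω hω => ?_
        obtain ⟨N, hN, -, -⟩ := exists_numSamples_eq ⟨T, hω⟩
        refine ⟨N, hN, ?_⟩
        have hle := numSamples_le hω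
        rw [hN] at hle
        have hNT : N ≤ T := by exact_mod_cast hle
        exact (Nat.cast_le.2 hNT).trans (Nat.floor_le hb0)

end Tail

/-! ### Correctness and running time of the program -/

section Program

/-- Every comparison of two states identifies at most two values of the flow. -/
theorem card_le_card_image_flow {Z : Type*} [Fintype Z] [DecidableEq Z] {c : ℕ → Comparison Z}
    (hc : ∀ t, (c t).set.card = 2 ∧ (c t).winner ∈ (c t).set) (t : ℕ) :
    Fintype.card Z ≤ (Finset.univ.image (flow c t)).card + t := by
  induction t with
  | zero =>
    rw [add_zero, Finset.card_image_of_injective _ (f := flow c 0) fun x y h => h,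
      Finset.card_univ]
  | succ t ih =>
    obtain ⟨h2, hw⟩ := hc t
    obtain ⟨b, hb⟩ : ∃ b, (c t).set.erase (c t).winner = {b} :=
      Finset.card_eq_one.1 (by rw [Finset.card_erase_of_mem hw, h2])
    have hmove : ∀ x, x ≠ b → move (c t) x = x := by
      intro x hx
      rw [move, if_pos]
      by_contra! h
      have : x ∈ (c t).set.erase (c t).winner := Finset.mem_erase.2 ⟨h.2, h.1⟩
      rw [hb, Finset.mem_singleton] at this
      exact hx this
    -- Only the loser `b` moves, so its old value is the only one that the image can lose.
    have hsub : Finset.univ.image (flow c t) ⊆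
        insert (flow c t b) (Finset.univ.image (flow c (t + 1))) := by
      intro z hz
      obtain ⟨x, -, rfl⟩ := Finset.mem_image.1 hz
      by_cases hx : x = b
      · rw [hx]; exact Finset.mem_insert_self _ _
      · refine Finset.mem_insert_of_mem (Finset.mem_image.2 ⟨x, Finset.mem_univ x, ?_⟩)
        rw [flow, hmove x hx]
    have := (Finset.card_le_card hsub).trans (Finset.card_insert_le _ _)
    omega

theorem Coalesced.card_le {Z : Type*} [Fintype Z] [DecidableEq Z] {c : ℕ → Comparison Z}
    (hc : ∀ t, (c t).set.card = 2 ∧ (c t).winner ∈ (c t).set) {t : ℕ} (h : Coalesced c t) :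
    Fintype.card Z ≤ t + 1 := by
  have h1 := card_le_card_image_flow hc t
  have h2 : (Finset.univ.image (flow c t)).card ≤ 1 := by
    rw [Finset.card_le_one]
    intro a ha b hb
    obtain ⟨x, -, rfl⟩ := Finset.mem_image.1 ha
    obtain ⟨y, -, rfl⟩ := Finset.mem_image.1 hb
    exact h x y
  omega

theorem exists_presents {n : ℕ} {c : ℕ → Comparison (Fin n)}
    (hc : ∀ t, (c t).set.card = 2) : ∃ o, Presents o c := by
  have h : ∀ t, ∃ p : Fin n × Fin n, (c t).set = {p.1, p.2} := fun t => by
    obtain ⟨a, b, -, h⟩ := Finset.card_eq_two.1 (hc t)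
    exact ⟨(a, b), h⟩
  choose p hp using h
  exact ⟨fun t => ((p t).1.val, (p t).2.val, (c t).winner.val),
    fun t => ⟨(p t).1, (p t).2, hp t, rfl⟩⟩

/-! ### Loop invariants and step counts of the program -/

variable {o : ℕ → ℕ × ℕ × ℕ}

/-- The rule for counting loops. -/
theorem exec_forEach {p : Cmd Var} {m B : ℕ} {I : ℕ → State Var → Prop}
    (hI : ∀ x s, I x s → s.var .x = x ∧ s.var .n = m)
    (hstep : ∀ x s, x < m → I x s →
      ∃ s' k, Exec o p s s' k ∧ k ≤ B ∧ I (x + 1) (s'.set .x (s'.var .x + 1)))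
    (s : State Var) (h0 : I 0 (s.set .x 0)) :
    ∃ s' k, Exec o (forEach p) s s' k ∧ k ≤ m * (B + 2) + 2 ∧ I m s' := by
  -- Induction on the remaining iterations `d`; each costs the body plus one test and one increment.
  have hloop : ∀ d x s, x + d = m → I x s →
      ∃ s' k, Exec o (.while (.lt .x .n) (.seq p (.succ .x))) s s' k ∧
        k ≤ d * (B + 2) + 1 ∧ I m s' := by
    intro d
    induction d with
    | zero =>
      intro x s hx hs
      obtain ⟨h1, h2⟩ := hI x s hs
      refine ⟨s, 1, .while_false ?_, by omega, by rwa [← hx]⟩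
      change ¬ s.var .x < s.var .n
      omega
    | succ d ih =>
      intro x s hx hs
      obtain ⟨h1, h2⟩ := hI x s hs
      obtain ⟨s₁, k₁, he₁, hk₁, hs₁⟩ := hstep x s (by omega) hs
      obtain ⟨s₂, k₂, he₂, hk₂, hs₂⟩ := ih (x + 1) _ (by omega) hs₁
      refine ⟨s₂, _, .while_true ?_ (.seq he₁ (.succ _ _)) he₂, ?_, hs₂⟩
      · change s.var .x < s.var .n
        omega
      · rw [Nat.succ_mul]; omega
  obtain ⟨s', k, he, hk, hs'⟩ := hloop m 0 _ (by omega) h0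
  exact ⟨s', _, .seq (.const _ _ _) he, by omega, hs'⟩

theorem exec_initArray {m : ℕ} (s : State Var) (hn : s.var .n = m) (hz : s.var .zero = 0) :
    ∃ s' k, Exec o initArray s s' k ∧ k ≤ m * 3 + 2 ∧
      s'.var .n = m ∧ s'.var .zero = 0 ∧ s'.drawn = s.drawn ∧ ∀ y < m, s'.arr y = y := by
  obtain ⟨s', k, he, hk, -, h⟩ := exec_forEach (o := o) (p := .store .x .x) (m := m) (B := 1)
    (I := fun x s' => s'.var .x = x ∧ s'.var .n = m ∧ s'.var .zero = 0 ∧ s'.drawn = s.drawn ∧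
      ∀ y < x, s'.arr y = y)
    (fun x s' h => ⟨h.1, h.2.1⟩)
    (fun x s' _ h => by
      obtain ⟨h1, h2, h3, h4, h5⟩ := h
      refine ⟨_, _, .store _ _ _, le_rfl, ?_⟩
      refine ⟨by simp [State.set, h1], by simpa [State.set] using h2,
        by simpa [State.set] using h3, h4, fun y hy => ?_⟩
      simp only [State.set, h1, Function.update_apply]
      split_ifs with h
      · exact h.symm
      · exact h5 y (by omega))
    s ⟨by simp [State.set], by simpa [State.set] using hn, by simpa [State.set] using hz, rfl,
      by simp⟩
  exact ⟨s', k, he, hk, h⟩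

open Classical in
theorem exec_checkCoalescence {m : ℕ} (s : State Var) (hn : s.var .n = m)
    (hz : s.var .zero = 0) :
    ∃ s' k, Exec o checkCoalescence s s' k ∧ k ≤ m * 5 + 4 ∧
      s'.var .n = m ∧ s'.var .zero = 0 ∧ s'.drawn = s.drawn ∧ s'.arr = s.arr ∧
      s'.var .coal = if ∀ y < m, s.arr y = s.arr 0 then 1 else 0 := by
  obtain ⟨s', k, he, hk, -, h1, h2, h3, h4, -, h5⟩ := exec_forEach (o := o)
    (p := .seq (.load .v .x) (.ite (.eq .v .u) .skip (.const .coal 0))) (m := m) (B := 3)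
    (I := fun x s' => s'.var .x = x ∧ s'.var .n = m ∧ s'.var .zero = 0 ∧ s'.drawn = s.drawn ∧
      s'.arr = s.arr ∧ s'.var .u = s.arr 0 ∧
      s'.var .coal = if ∀ y < x, s.arr y = s.arr 0 then 1 else 0)
    (fun x s' h => ⟨h.1, h.2.1⟩)
    (fun x s' _ h => by
      obtain ⟨h1, h2, h3, h4, h5, h6, h7⟩ := h
      by_cases hx : s.arr x = s.arr 0
      · refine ⟨_, _, .seq (.load _ _ _) (.ite_true ?_ (.skip _)), le_rfl, ?_⟩
        · simp [Test.Holds, State.set, h1, h5, h6, hx]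
        · have : (∀ y < x + 1, s.arr y = s.arr 0) ↔ ∀ y < x, s.arr y = s.arr 0 := by
            constructor
            · intro h y hy; exact h y (by omega)
            · intro h y hy
              rcases Nat.lt_succ_iff_lt_or_eq.1 hy with hy | rfl
              exacts [h y hy, hx]
          simp only [this]
          simp [State.set, h1, h2, h3, h4, h5, h6, h7]
      · refine ⟨_, _, .seq (.load _ _ _) (.ite_false ?_ (.const _ _ _)), le_rfl, ?_⟩
        · simp [Test.Holds, State.set, h1, h5, h6, hx]
        · have : ¬ ∀ y < x + 1, s.arr y = s.arr 0 := fun h => hx (h x (by omega))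
          simp only [this]
          simp [State.set, h1, h2, h3, h4, h5, h6])
    ((s.set .coal 1).set .u ((s.set .coal 1).arr ((s.set .coal 1).var .zero)))
    (by simp [State.set, hn, hz])
  exact ⟨s', _, .seq (.const _ _ _) (.seq (.load _ _ _) he), by omega, h1, h2, h3, h4, h5⟩

theorem exec_drawAndUpdate {m : ℕ} (s : State Var) (hn : s.var .n = m) (hz : s.var .zero = 0)
    {i j w : ℕ} (ho : o s.drawn = (i, j, w)) :
    ∃ s' k, Exec o drawAndUpdate s s' k ∧ k ≤ m * 7 + 3 ∧
      s'.var .n = m ∧ s'.var .zero = 0 ∧ s'.drawn = s.drawn + 1 ∧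
      ∀ y < m, s'.arr y = if y ≠ w ∧ (y = i ∨ y = j) then s.arr w else s.arr y := by
  set A : ℕ → ℕ := fun y => if y ≠ w ∧ (y = i ∨ y = j) then s.arr w else s.arr y with hA
  obtain ⟨s', k, he, hk, -, h1, h2, h3, -, -, -, h4⟩ := exec_forEach (o := o)
    (p := .ite (.eq .x .w) .skip <|
      .ite (.eq .x .i) (.seq (.load .v .w) (.store .x .v)) <|
        .ite (.eq .x .j) (.seq (.load .v .w) (.store .x .v)) .skip) (m := m) (B := 5)
    (I := fun x s' => s'.var .x = x ∧ s'.var .n = m ∧ s'.var .zero = 0 ∧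
      s'.drawn = s.drawn + 1 ∧ s'.var .i = i ∧ s'.var .j = j ∧ s'.var .w = w ∧
      ∀ y, s'.arr y = if y < x then A y else s.arr y)
    (fun x s' h => ⟨h.1, h.2.1⟩)
    (fun x s' _ h => by
      obtain ⟨h1, h2, h3, h4, hi, hj, hw, h5⟩ := h
      -- The winner's entry is untouched, so reading it during the in-place update still yields the
      -- old value.
      have harr : s'.arr w = s.arr w := by rw [h5]; simp [hA]
      have hkeep : A x = s.arr x → ∀ y, s'.arr y = if y < x + 1 then A y else s.arr y := by
        intro hx y
        rw [h5]
        rcases lt_trichotomy y x with h | rfl | h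
        · rw [if_pos h, if_pos (by omega)]
        · rw [if_neg (lt_irrefl _), if_pos (by omega), hx]
        · rw [if_neg (by omega), if_neg (by omega)]
      have hput : A x = s.arr w → ∀ y, Function.update s'.arr x (s.arr w) y =
          if y < x + 1 then A y else s.arr y := by
        intro hx y
        rw [Function.update_apply, h5]
        rcases lt_trichotomy y x with h | rfl | h
        · rw [if_neg h.ne, if_pos h, if_pos (by omega)]
        · rw [if_pos rfl, if_pos (by omega), hx]
        · rw [if_neg h.ne', if_neg (by omega), if_neg (by omega)]
      by_cases hxw : x = w
      · refine ⟨_, _, .ite_true ?_ (.skip _), by omega, ?_⟩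
        · simp [Test.Holds, h1, hw, hxw]
        · simpa [State.set, h1, h2, h3, h4, hi, hj, hw] using hkeep (by simp [hA, hxw])
      by_cases hxi : x = i
      · refine ⟨_, _, .ite_false ?_ (.ite_true ?_ (.seq (.load _ _ _) (.store _ _ _))),
          by omega, ?_⟩
        · simp [Test.Holds, h1, hw, hxw]
        · simp [Test.Holds, h1, hi, hxi]
        · simpa [State.set, h1, h2, h3, h4, hi, hj, hw, harr] using
            hput (by rw [hA]; exact if_pos ⟨hxw, Or.inl hxi⟩)
      by_cases hxj : x = j
      · refine ⟨_, _, .ite_false ?_ (.ite_false ?_ (.ite_true ?_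
          (.seq (.load _ _ _) (.store _ _ _)))), by omega, ?_⟩
        · simp [Test.Holds, h1, hw, hxw]
        · simp [Test.Holds, h1, hi, hxi]
        · simp [Test.Holds, h1, hj, hxj]
        · simpa [State.set, h1, h2, h3, h4, hi, hj, hw, harr] using
            hput (by rw [hA]; exact if_pos ⟨hxw, Or.inr hxj⟩)
      · refine ⟨_, _, .ite_false ?_ (.ite_false ?_ (.ite_false ?_ (.skip _))), by omega, ?_⟩
        · simp [Test.Holds, h1, hw, hxw]
        · simp [Test.Holds, h1, hi, hxi]
        · simp [Test.Holds, h1, hj, hxj]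
        · simpa [State.set, h1, h2, h3, h4, hi, hj, hw] using
            hkeep (by rw [hA]; exact if_neg fun h => h.2.elim hxi hxj))
    { (((s.set .i (o s.drawn).1).set .j (o s.drawn).2.1).set .w (o s.drawn).2.2) with
      drawn := s.drawn + 1 }
    (by simp [State.set, hn, hz, ho])
  exact ⟨s', _, .seq (.sample _ _ _ _) he, by omega, h1, h2, h3, fun y hy => by
    rw [h4, if_pos hy]⟩

theorem flow_succ_val {n : ℕ} {c : ℕ → Comparison (Fin n)} {t : ℕ} {i j : Fin n}
    (hset : (c t).set = {i, j}) {a : ℕ → ℕ} (ha : ∀ y : Fin n, a y = (flow c t y).val)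
    (y : Fin n) :
    (if y.val ≠ (c t).winner.val ∧ (y.val = i.val ∨ y.val = j.val) then a (c t).winner.val
      else a y.val) = (flow c (t + 1) y).val := by
  rw [flow, move, hset]
  simp only [Finset.mem_insert, Finset.mem_singleton, ← Fin.ext_iff, ne_eq]
  split_ifs with h1 h2 h2
  · tauto
  · exact ha _
  · exact ha _
  · tauto

theorem coalesced_iff_forall_lt {n : ℕ} [NeZero n] {c : ℕ → Comparison (Fin n)} {t : ℕ}
    {a : ℕ → ℕ} (ha : ∀ y : Fin n, a y = (flow c t y).val) :
    (∀ y < n, a y = a 0) ↔ Coalesced c t := by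
  have h0 : a 0 = (flow c t 0).val := by rw [← ha]; simp
  constructor
  · intro h x y
    have hx := h x x.2
    have hy := h y y.2
    rw [ha, h0] at hx hy
    exact Fin.ext (hx.trans hy.symm)
  · intro h y hy
    rw [h0, ha ⟨y, hy⟩, h ⟨y, hy⟩ 0]

open Classical in
/-- The main loop of the program maintains the flow in the array and stops when it coalesces. -/
theorem exec_mainLoop {n : ℕ} [NeZero n] {c : ℕ → Comparison (Fin n)} (ho : Presents o c) {N : ℕ}
    (hN : Coalesced c N) (hlt : ∀ t < N, ¬ Coalesced c t) (d : ℕ) :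
    ∀ (t : ℕ) (s : State Var), t + d = N → s.var .n = n → s.var .zero = 0 → s.drawn = t →
      (∀ y : Fin n, s.arr y = (flow c t y).val) →
      s.var .coal = (if Coalesced c t then 1 else 0) →
      ∃ s' k, Exec o (.while (.eq .coal .zero) (.seq drawAndUpdate checkCoalescence)) s s' k ∧
        k ≤ d * (n * 12 + 8) + 1 ∧ s'.var .zero = 0 ∧ s'.drawn = N ∧
        ∀ y : Fin n, s'.arr y = (flow c N y).val := by
  induction d with
  | zero =>
    intro t s ht hn hz hd harr hcoal
    obtain rfl : t = N := by omega
    refine ⟨s, 1, .while_false ?_, by omega, hz, hd, harr⟩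
    rw [if_pos hN] at hcoal
    simp [Test.Holds, hcoal, hz]
  | succ d ih =>
    intro t s ht hn hz hd harr hcoal
    obtain ⟨i, j, hset, hot⟩ := ho t
    rw [if_neg (hlt t (by omega))] at hcoal
    obtain ⟨s₁, k₁, he₁, hk₁, hn₁, hz₁, hd₁, harr₁⟩ :=
      exec_drawAndUpdate s hn hz (by rw [hd]; exact hot)
    obtain ⟨s₂, k₂, he₂, hk₂, hn₂, hz₂, hd₂, harr₂, hcoal₂⟩ :=
      exec_checkCoalescence (o := o) s₁ hn₁ hz₁
    have ha : ∀ y : Fin n, s₁.arr y = (flow c (t + 1) y).val := fun y => by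
      rw [harr₁ y y.2, flow_succ_val hset harr]
    obtain ⟨s₃, k₃, he₃, hk₃, h₃⟩ := ih (t + 1) s₂ (by omega) hn₂ hz₂ (by omega)
      (fun y => by rw [harr₂, ha]) (by simp only [hcoal₂, coalesced_iff_forall_lt ha])
    refine ⟨s₃, _, .while_true ?_ (.seq he₁ he₂) he₃, ?_, h₃⟩
    · simp [Test.Holds, hcoal, hz]
    -- One round costs `7 * n + 3` for the update, `5 * n + 4` for the check and one for the loop
    -- test.
    · rw [Nat.succ_mul]; omega

/-- The program halts with the output of coupling from the past. -/
theorem exec_exactSampler {n : ℕ} [NeZero n] {c : ℕ → Comparison (Fin n)} (ho : Presents o c)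
    {N : ℕ} (hN : Coalesced c N) (hlt : ∀ t < N, ¬ Coalesced c t) (s : State Var)
    (hn : s.var .n = n) (hd : s.drawn = 0) :
    ∃ s' k, Exec o exactSampler s s' k ∧ s'.drawn = N ∧ s'.var .out = (output c).val ∧
      k ≤ N * (n * 12 + 8) + n * 8 + 9 := by
  classical
  obtain ⟨s₁, k₁, he₁, hk₁, hn₁, hz₁, hd₁, harr₁⟩ :=
    exec_initArray (o := o) (s.set .zero 0) (m := n) (by simpa [State.set] using hn)
      (by simp [State.set])
  obtain ⟨s₂, k₂, he₂, hk₂, hn₂, hz₂, hd₂, harr₂, hcoal₂⟩ :=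
    exec_checkCoalescence (o := o) s₁ hn₁ hz₁
  have ha : ∀ y : Fin n, s₁.arr y = (flow c 0 y).val := fun y => harr₁ y y.2
  obtain ⟨s₃, k₃, he₃, hk₃, hz₃, hd₃, harr₃⟩ := exec_mainLoop ho hN hlt N 0 s₂ (by omega) hn₂ hz₂
    (by rw [hd₂, hd₁]; exact hd) (fun y => by rw [harr₂, ha])
    (by simp only [hcoal₂, coalesced_iff_forall_lt ha])
  refine ⟨_, _, .seq (.const _ _ _) (.seq he₁ (.seq he₂ (.seq he₃ (.load _ _ _)))), hd₃, ?_,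
    by omega⟩
  have := harr₃ 0
  rw [flow_eq_output hN] at this
  simpa [State.set, hz₃] using this

end Program
end CFTP

end

/-! ### The main theorem -/

theorem theorem1 :
    ∃ (C : ℝ) (p : Polynomial ℕ), 0 < C ∧
      ∀ (n : ℕ) [NeZero n] (L : CFTP.LocalSamplingScheme (Fin n)),
        L.IsPairwise → L.graph.Connected →
        -- the canonical chain: a transition matrix with positive absolute spectral gap,
        -- whose unique stationary distribution is the target distribution
        L.chain ∈ Matrix.rowStochastic ℝ (Fin n) ∧
        (∀ π ∈ stdSimplex ℝ (Fin n), Matrix.vecMul π L.chain = π ↔ π = L.prob) ∧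
        0 < CFTP.absSpectralGap L.chain ∧
        -- independent samples `ξ 0, ξ 1, …` from the local sampling scheme
        ∀ {Ω : Type*} [MeasurableSpace Ω] (μ : Measure Ω) [IsProbabilityMeasure μ]
          (ξ : ℕ → Ω → CFTP.Comparison (Fin n)),
          (∀ t, Measurable (ξ t)) → iIndepFun ξ μ → (∀ t, HasLaw (ξ t) L.samp.toMeasure μ) →
          -- every draw simulates one step of the canonical chain from every state
          (∀ t x y, μ {ω | CFTP.move (ξ t ω) x = y} = ENNReal.ofReal (L.chain x y)) ∧
          -- the algorithm stops almost surely
          (∀ᵐ ω ∂μ, CFTP.numSamples (fun t => ξ t ω) ≠ ⊤) ∧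
          -- the output is distributed exactly as the target distribution
          (∀ x, μ {ω | CFTP.numSamples (fun t => ξ t ω) ≠ ⊤ ∧
              CFTP.output (fun t => ξ t ω) = x} = L.D x) ∧
          -- the number of samples
          (∀ δ : ℝ, 0 < δ →
            ENNReal.ofReal (1 - δ) ≤
              μ {ω | ∃ N : ℕ, CFTP.numSamples (fun t => ξ t ω) = N ∧
                (N : ℝ) ≤ C * (n * Real.log (1 / L.minProb) / CFTP.absSpectralGap L.chain) *
                  max 1 (Real.log (1 / δ))}) ∧
          -- the program, run on these samples, halts with this output and this number of samples,
          -- in time polynomial in the number of samples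
          (∀ᵐ ω ∂μ, ∃ N : ℕ, CFTP.numSamples (fun t => ξ t ω) = N ∧
            (∃ o, CFTP.Presents o (fun t => ξ t ω)) ∧
            ∀ o, CFTP.Presents o (fun t => ξ t ω) →
              ∀ s : CFTP.State CFTP.Var, s.var .n = n → s.drawn = 0 →
                ∃ s' k, CFTP.Exec o CFTP.exactSampler s s' k ∧
                  s'.drawn = N ∧ s'.var .out = (CFTP.output (fun t => ξ t ω)).val ∧
                  k ≤ p.eval N) := by
  -- The polynomial is the step bound `N * (n * 12 + 8) + n * 8 + 9` with `n` replaced by `N + 1`.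
  refine ⟨12, 12 * Polynomial.X ^ 2 + 28 * Polynomial.X + 17, by norm_num, ?_⟩
  intro n _ L hL hc
  refine ⟨CFTP.LocalSamplingScheme.chain_mem_rowStochastic hL,
    fun π hπ => CFTP.LocalSamplingScheme.vecMul_chain_eq_iff hc hπ,
    (CFTP.LocalSamplingScheme.absSpectralGap_chain hL hc).1, ?_⟩
  intro Ω _ μ _ ξ hm hind hlaw
  refine ⟨CFTP.measure_move_eq hL hm hlaw, CFTP.ae_numSamples_ne_top hL hc hm hind hlaw,
    CFTP.measure_output_eq hL hc hm hind hlaw,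
    fun δ hδ => CFTP.measure_numSamples_le hL hc hm hind hlaw hδ, ?_⟩
  filter_upwards [CFTP.ae_numSamples_ne_top hL hc hm hind hlaw,
    CFTP.ae_sample_mem hL hlaw] with ω hω hmem
  obtain ⟨N, hN, hcoal, hlt⟩ :=
    CFTP.exists_numSamples_eq (CFTP.exists_coalesced_of_numSamples_ne_top hω)
  refine ⟨N, hN, CFTP.exists_presents fun t => (hmem t).1, fun o ho s hn hd => ?_⟩
  obtain ⟨s', k, he, hs', hout, hk⟩ := CFTP.exec_exactSampler ho hcoal hlt s hn hd
  refine ⟨s', k, he, hs', hout, hk.trans ?_⟩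
  have hcard := hcoal.card_le hmem
  rw [Fintype.card_fin] at hcard
  simp only [Polynomial.eval_add, Polynomial.eval_mul, Polynomial.eval_pow, Polynomial.eval_X,
    Polynomial.eval_ofNat]
  nlinarith [Nat.mul_le_mul_left N hcard]
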